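/- **Setting.** Let $\mathbb X$ be a standard Borel space with metric $d$, and let $\mathbb Y$ and $\mathbb U$ be finite. Consider the partially observed controlled Markov process with transition kernel $\mathcal T(dx'\mid x,u)$, observation channel $Q(dy\mid x)$ and cost $c:\mathbb X\times\mathbb U\to\mathbb R$: $X_0\sim z$, $X_{t+1}\sim\mathcal T(\cdot\mid X_t,U_t)$, $Y_t\sim Q(\cdot\mid X_t)$, and $U_t=\gamma_t(Y_{[0,t]},U_{[0,t-1]})$ for an admissible policy $\gamma$; write $E_z^\gamma$ for the corresponding expectation. Let $\beta\in(0,1)$ and assume that there are $\alpha,K_1\ge 0$ such that for all $x,x',u$ $$\|\mathcal T(\cdot\mid x,u)-\mathcal T(\cdot\mid x',u)\|_{TV}\le\alpha\,d(x,x'),\qquad |c(x,u)-c(x',u)|\le K_1\,d(x,x'),$$ where $\|\mu-\nu\|_{TV}=2\sup_B|\mu(B)-\nu(B)|$, and that $c$ is bounded, with $\|c\|_\infty=\sup_{x,u}|c(x,u)|$. **Notation.** Fix a window length $N\ge 0$. For a prior $z$ and a window $I=(y_{[0,N]},u_{[0,N-1]})$ let $\psi(z,I)=P^{z}(X_N\in\cdot\mid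 y_{[0,N]},u_{[0,N-1]})$ (on windows that are null under $z$, fix any version; the same version is used throughout), and let $z_t^-=P^{z_0^-}(X_t\in\cdot\mid Y_{[0,t-1]},U_{[0,t-1]})$ be the predictor. For $\hat z=(z,I)$ let $$J_\beta(\hat z,\gamma)=E_z^\gamma\Big[\sum_{t\ge0}\beta^t c(X_{N+t},U_{N+t})\,\Big|\,Y_{[0,N]}=y_{[0,N]},\,U_{[0,N-1]}=u_{[0,N-1]}\Big],\qquad J_\beta^*(\hat z)=\inf_\gamma J_\beta(\hat z,\gamma),$$ where $\gamma$ is used from time $N$ on and the infimum is over all admissible policies. Fix $z^*\in\mathcal P(\mathbb X)$. Let $\phi^N$ be an optimal policy of the finite model in which the predictor is always replaced by $z^*$, that is, $\phi^N(I)$ attains the minimum in $$J_\beta^N(I)=\min_{u\in\mathbb U}\Big(\int c(x,u)\,\psi(z^*,I)(dx)+\beta\sum_{y\in\mathbb Y}J_\beta^N(I')\,P(y\mid\psi(z^*,I),u)\Big),$$ where $I'=(y_{[1,N]},y,u_{[1,N-1]},u)$ is the next window (the last $N+1$ observations and the last $N$ actions, in particular $I'=y$ if $N=0$) and $P(y\mid\pi,u)=\int\!\!\int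 Q(y\mid x')\,\mathcal T(dx'\mid x,u)\,\pi(dx)$. Let $\tilde\phi^N(z,I)=\phi^N(I)$ be its extension, used as a policy at all times $n\ge N$. Let $\hat\Gamma$ be the set of policies whose first $N$ actions are chosen by an arbitrary admissible policy and whose action at time $N+t$, $t\ge0$, is a function of $t$ and $\hat z_t=(z_t^-,Y_{[t,t+N]},U_{[t,t+N-1]})$. Put $$\bar L_t^N=\sup_{\hat\gamma\in\hat\Gamma}E_{z_0^-}^{\hat\gamma}\Big[W_1\big(\psi(z_t^-,(Y_{[t,t+N]},U_{[t,t+N-1]})),\ \psi(z^*,(Y_{[t,t+N]},U_{[t,t+N-1]}))\big)\Big]\in[0,\infty],$$ where $W_1(\mu,\nu)\in[0,\infty]$ is the supremum of $\int f\,d\mu-\int f\,d\nu$ over the $1$-Lipschitz functions $f:\mathbb X\to\mathbb R$ that are integrable for both measures. **Theorem.** For every prior $z_0^-\in\mathcal P(\mathbb X)$ and every admissible policy $\hat\gamma$ acting on the first $N$ steps, with $I_0^N=(Y_{[0,N]},U_{[0,N-1]})$ the resulting random window and $\hat z_0=(z_0^-,I_0^N)$, $$E_{z_0^-}^{\hat\gamma}\Big[\big|J_\beta(\hat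 z_0,\tilde\phi^N)-J_\beta^*(\hat z_0)\big|\Big]\le 2\Big(K_1+\frac{\alpha\beta\|c\|_\infty}{1-\beta}\Big)\sum_{t=0}^\infty\beta^t\,\bar L_t^N ,$$ where the expectation is over the random window $I_0^N$ (and $0\cdot\infty=0$ on the right). -/

import Mathlib

open MeasureTheory ProbabilityTheory
open scoped ENNReal

noncomputable section

/-- A measure of total mass one, as an element of `ProbabilityMeasure X`. -/
def bundle {X : Type*} [MeasurableSpace X] (μ : Measure X) (h : IsProbabilityMeasure μ) :
    ProbabilityMeasure X := ⟨μ, h⟩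

/-! ### Distances between probability measures -/

/-- The total variation distance `2 * sup_B |μ(B) - ν(B)|`, with the factor `2`; it equals the
supremum of `|∫ f dμ - ∫ f dν|` over measurable `f` with `‖f‖_∞ ≤ 1`. -/
def tvDist {X : Type*} [MeasurableSpace X] (μ ν : Measure X) : ℝ :=
  2 * ⨆ B : {B : Set X // MeasurableSet B}, |μ.real B.1 - ν.real B.1|

/-- The Wasserstein distance of order one in its Kantorovich-Rubinstein form, with values in
`[0, ∞]`: the supremum of `∫ f dμ - ∫ f dν` over all `1`-Lipschitz functions `f` for which both
integrals exist (on a bounded space these are all `1`-Lipschitz functions). -/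
def wasserstein {X : Type*} [MetricSpace X] [MeasurableSpace X] (μ ν : Measure X) : ℝ≥0∞ :=
  ⨆ (f : X → ℝ) (_ : LipschitzWith 1 f) (_ : Integrable f μ) (_ : Integrable f ν),
    ENNReal.ofReal (∫ x, f x ∂μ - ∫ x, f x ∂ν)

/-! ### Partially observed controlled Markov processes -/

/-- The data of a POMDP: the transition kernel `T(dx' | x, u)`, the observation channel
`Q(dy | x)` and the stage-wise cost `c(x, u)`. -/
structure POMDP (X Y U : Type*) [MeasurableSpace X] [MeasurableSpace Y] [MeasurableSpace U] where
  transition : Kernel (X × U) X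
  channel : Kernel X Y
  cost : X → U → ℝ
  markov_transition : IsMarkovKernel transition
  markov_channel : IsMarkovKernel channel

/-- An admissible policy: at time `t` the action is a function of the observations
`y_0, …, y_t` and of the past actions `u_0, …, u_{t-1}`. (For finite `Y` and `U` there is no
measurability to require.) -/
abbrev Policy (Y U : Type*) : Type _ := (t : ℕ) → (Fin (t + 1) → Y) → (Fin t → U) → U

/-- The window information `I^N`: `N + 1` consecutive observations and the `N` actions taken
between them, both listed in the order of time. -/
abbrev Window (Y U : Type*) (N : ℕ) : Type _ := (Fin (N + 1) → Y) × (Fin N → U)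

/-- The policy that plays the fixed actions `u_0, …, u_{n-1}` at the times `0, …, n-1` and follows
`γ` from time `n` on. -/
def Policy.withPrefix {Y U : Type*} {n : ℕ} (u : Fin n → U) (γ : Policy Y U) : Policy Y U :=
  fun t ys us => if h : t < n then u ⟨t, h⟩ else γ t ys us

/-- The window that follows `w` when the action `u` is taken and then `y` is observed. -/
def Window.next {Y U : Type*} {N : ℕ} (w : Window Y U N) (u : U) (y : Y) : Window Y U N :=
  (Fin.tail (Fin.snoc (α := fun _ => Y) w.1 y), Fin.tail (Fin.snoc (α := fun _ => U) w.2 u))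

/-- The sliding-window policy induced by a map `φ` on windows: at every time `n ≥ N` it applies `φ`
to the last `N + 1` observations and the last `N` actions, whatever the belief is. (Before time `N`
there is no full window; the value there is never used.) -/
def slidingPolicy {Y U : Type*} [Nonempty U] {N : ℕ} (φ : Window Y U N → U) : Policy Y U :=
  fun n ys us =>
    if h : N ≤ n then
      φ (fun i => ys ⟨n - N + i, by omega⟩, fun i => us ⟨n - N + i, by omega⟩)
    else Classical.arbitrary U

/-- The event that the first `n` observations are `y_0, …, y_{n-1}`. -/
def obsEvent {X Y U : Type*} {n : ℕ} (y : Fin n → Y) : Set (ℕ → X × Y × U) :=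
  {ω | ∀ i : Fin n, (ω i).2.1 = y i}

/-- The window `(Y_{[t, t+N]}, U_{[t, t+N-1]})` of a trajectory. -/
def windowAt {X Y U : Type*} (N t : ℕ) (ω : ℕ → X × Y × U) : Window Y U N :=
  (fun i => (ω (t + i)).2.1, fun i => (ω (t + i)).2.2)

namespace POMDP

section

variable {X Y U : Type*} [MeasurableSpace X] [MeasurableSpace Y] [MeasurableSpace U]

instance (M : POMDP X Y U) : IsMarkovKernel M.transition := M.markov_transition

instance (M : POMDP X Y U) : IsMarkovKernel M.channel := M.markov_channel

/-- Given the trajectory `(x_i, y_i, u_i)`, `i ≤ n`, and the new pair `(x_{n+1}, y_{n+1})`, append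
the action that `γ` prescribes at time `n + 1`. -/
def extend (γ : Policy Y U) (n : ℕ)
    (p : ((_ : Finset.Iic n) → X × Y × U) × (X × Y)) : X × Y × U :=
  (p.2.1, p.2.2,
    γ (n + 1)
      (fun i : Fin (n + 2) =>
        if h : (i : ℕ) ≤ n then (p.1 ⟨i, Finset.mem_Iic.2 h⟩).2.1 else p.2.2)
      (fun i : Fin (n + 1) => (p.1 ⟨i, Finset.mem_Iic.2 (Nat.lt_succ_iff.1 i.2)⟩).2.2))

/-- The law of `(X_{n+1}, Y_{n+1}, U_{n+1})` given the trajectory up to time `n`, under `γ`: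
`X_{n+1} ~ T(· | x_n, u_n)`, `Y_{n+1} ~ Q(· | X_{n+1})`, and `U_{n+1}` is prescribed by `γ`. -/
def stepKernel (M : POMDP X Y U) (γ : Policy Y U) (n : ℕ) :
    Kernel ((_ : Finset.Iic n) → X × Y × U) (X × Y × U) :=
  (Kernel.id ×ₖ
    ((M.transition ⊗ₖ Kernel.prodMkLeft (X × U) M.channel).comap
      (fun h : (_ : Finset.Iic n) → X × Y × U =>
        ((h ⟨n, Finset.mem_Iic.2 le_rfl⟩).1, (h ⟨n, Finset.mem_Iic.2 le_rfl⟩).2.2))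
      (by fun_prop))).map (extend γ n)

/-- The law of `(X_0, Y_0, U_0)`: `X_0 ~ μ`, `Y_0 ~ Q(· | X_0)` and `U_0 = γ_0(Y_0)`. -/
def initialLaw (M : POMDP X Y U) (μ : Measure X) (γ : Policy Y U) : Measure (X × Y × U) :=
  (μ ⊗ₘ M.channel).map (fun p => (p.1, p.2, γ 0 (fun _ => p.2) Fin.elim0))

theorem measurable_initial [Finite Y] [MeasurableSingletonClass Y] (γ : Policy Y U) :
    Measurable (fun p : X × Y => (p.1, p.2, γ 0 (fun _ => p.2) Fin.elim0)) := by
  have hγ : Measurable (fun y : Y => γ 0 (fun _ => y) Fin.elim0) := measurable_of_countable _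
  exact measurable_fst.prodMk (measurable_snd.prodMk (hγ.comp measurable_snd))

variable [Finite Y] [MeasurableSingletonClass Y] [Finite U] [MeasurableSingletonClass U]

theorem measurable_extend (γ : Policy Y U) (n : ℕ) :
    Measurable (extend (X := X) γ n) := by
  have hγ : Measurable (fun q : (Fin (n + 2) → Y) × (Fin (n + 1) → U) => γ (n + 1) q.1 q.2) :=
    measurable_of_countable _
  have h₁ : Measurable (fun (p : ((_ : Finset.Iic n) → X × Y × U) × (X × Y)) (i : Fin (n + 2)) =>
      if h : (i : ℕ) ≤ n then (p.1 ⟨i, Finset.mem_Iic.2 h⟩).2.1 else p.2.2) := by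
    refine measurable_pi_lambda _ fun i => ?_
    split_ifs with h
    · fun_prop
    · fun_prop
  have h₂ : Measurable (fun (p : ((_ : Finset.Iic n) → X × Y × U) × (X × Y)) (i : Fin (n + 1)) =>
      (p.1 ⟨i, Finset.mem_Iic.2 (Nat.lt_succ_iff.1 i.2)⟩).2.2) := by
    fun_prop
  exact measurable_snd.fst.prodMk (measurable_snd.snd.prodMk (hγ.comp (h₁.prodMk h₂)))

instance (M : POMDP X Y U) (γ : Policy Y U) (n : ℕ) : IsMarkovKernel (M.stepKernel γ n) :=
  Kernel.IsMarkovKernel.map _ (measurable_extend γ n)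

instance (M : POMDP X Y U) (μ : Measure X) [IsProbabilityMeasure μ] (γ : Policy Y U) :
    IsProbabilityMeasure (M.initialLaw μ γ) :=
  Measure.isProbabilityMeasure_map (measurable_initial γ).aemeasurable

/-- The strategic measure `P_μ^γ` on trajectories `(X_t, Y_t, U_t)_{t ≥ 0}`: the law of the
controlled process with prior `μ` of `X_0` under the policy `γ`. -/
def pathLaw (M : POMDP X Y U) (μ : ProbabilityMeasure X) (γ : Policy Y U) :
    Measure (ℕ → X × Y × U) :=
  Kernel.trajMeasure (X := fun _ => X × Y × U) (M.initialLaw (μ : Measure X) γ) (M.stepKernel γ)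

instance (M : POMDP X Y U) (μ : ProbabilityMeasure X) (γ : Policy Y U) :
    IsProbabilityMeasure (M.pathLaw μ γ) := by
  unfold pathLaw
  infer_instance

variable [Nonempty U]

/-- The law of the trajectories with prior `z` when the actions `u_0, …, u_{n-1}` are played (and
some fixed action afterwards). -/
def openLoopLaw (M : POMDP X Y U) (z : ProbabilityMeasure X) {n : ℕ} (u : Fin n → U) :
    Measure (ℕ → X × Y × U) :=
  M.pathLaw z (Policy.withPrefix u fun _ _ _ => Classical.arbitrary U)

instance (M : POMDP X Y U) (z : ProbabilityMeasure X) {n : ℕ} (u : Fin n → U) :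
    IsProbabilityMeasure (M.openLoopLaw z u) := by
  unfold openLoopLaw
  infer_instance

open Classical in
/-- The conditional law of `X_m` given `Y_{[0, n-1]} = y` when the actions `u` are played, with the
value `d` if the conditioning event is null. -/
def condState (M : POMDP X Y U) (z : ProbabilityMeasure X) {n k : ℕ} (m : ℕ) (y : Fin n → Y)
    (u : Fin k → U) (d : ProbabilityMeasure X) : ProbabilityMeasure X :=
  if h : M.openLoopLaw z u (obsEvent y) = 0 then d
  else
    bundle (((M.openLoopLaw z u)[|obsEvent y]).map (fun ω => (ω m).1)) <| by
      have : IsProbabilityMeasure ((M.openLoopLaw z u)[|obsEvent y]) := cond_isProbabilityMeasure h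
      exact Measure.isProbabilityMeasure_map (measurable_pi_apply m).fst.aemeasurable

/-- The predictor `z_t^- = P^z(X_t ∈ · | y_{[0,t-1]}, u_{[0,t-1]})`; for `t = 0` this is `z`. -/
def predictor (M : POMDP X Y U) (z : ProbabilityMeasure X) (t : ℕ) (y : Fin t → Y)
    (u : Fin t → U) : ProbabilityMeasure X :=
  M.condState z t y u z

/-- The filter `ψ(z, y_{[0,N]}, u_{[0,N-1]}) = P^z(X_N ∈ · | y_{[0,N]}, u_{[0,N-1]})`. On windows
of probability zero under the prior `z` the conditional law is not determined; there the value
is `ρ w`. Different choices of `ρ` give all versions of the conditional law. -/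
def filter (M : POMDP X Y U) {N : ℕ} (ρ : Window Y U N → ProbabilityMeasure X)
    (z : ProbabilityMeasure X) (w : Window Y U N) : ProbabilityMeasure X :=
  M.condState z N w.1 w.2 (ρ w)

/-- `P(Y_{n+1} = y | Z_n = z, U_n = u)`. -/
def nextObsProb (M : POMDP X Y U) (z : ProbabilityMeasure X) (u : U) (y : Y) : ℝ :=
  ∫ x, ((M.channel ∘ₖ M.transition) (x, u)).real {y} ∂(z : Measure X)

/-- The class of policies that after the first `N` steps are Markov in the state
`ẑ_t = (z_t^-, Y_{[t,t+N]}, U_{[t,t+N-1]})`: the action at time `N + t` is a function of `ẑ_t`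
and `t`. The first `N` actions come from an arbitrary admissible policy. -/
def IsWindowMarkov (M : POMDP X Y U) (N : ℕ) (z : ProbabilityMeasure X) (γ : Policy Y U) : Prop :=
  ∃ g : ℕ → ProbabilityMeasure X → Window Y U N → U,
    ∀ (t : ℕ) (y : Fin (N + t + 1) → Y) (u : Fin (N + t) → U),
      γ (N + t) y u =
        g t (M.predictor z t (fun i => y ⟨i, by omega⟩) (fun i => u ⟨i, by omega⟩))
          (fun i => y ⟨t + i, by omega⟩, fun i => u ⟨t + i, by omega⟩)

/-- The cost `J_β(ẑ, γ)` of the policy `γ` in the true system from the state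
`ẑ = (z, y_{[0,N]}, u_{[0,N-1]})`: the conditional expectation of `∑_t β^t c(X_{N+t}, U_{N+t})`
given `Y_{[0,N]} = y` and `U_{[0,N-1]} = u`, where `X_0` has prior `z` and `γ` acts from time `N`
on. (Windows that are null under `z` get the value `0`.) -/
def costFrom (M : POMDP X Y U) (β : ℝ) {N : ℕ} (z : ProbabilityMeasure X) (w : Window Y U N)
    (γ : Policy Y U) : ℝ :=
  ∫ ω, ∑' t : ℕ, β ^ t * M.cost (ω (N + t)).1 (ω (N + t)).2.2
    ∂((M.pathLaw z (Policy.withPrefix w.2 γ))[|obsEvent w.1])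

/-- The optimal cost `J_β^*(ẑ)`: the infimum of the cost over all admissible policies. -/
def optCostFrom (M : POMDP X Y U) (β : ℝ) {N : ℕ} (z : ProbabilityMeasure X)
    (w : Window Y U N) : ℝ :=
  ⨅ γ : Policy Y U, M.costFrom β z w γ

/-- The right-hand side of the Bellman equation of the approximate finite model, in which the
predictor is always replaced by `zstar`: the cost of the action `u` at the window `w`, plus the
discounted expectation of `J` at the next window. -/
def approxQ (M : POMDP X Y U) (β : ℝ) {N : ℕ} (ρ : Window Y U N → ProbabilityMeasure X)
    (zstar : ProbabilityMeasure X) (J : Window Y U N → ℝ) (w : Window Y U N) (u : U) : ℝ :=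
  (∫ x, M.cost x u ∂(M.filter ρ zstar w : Measure X)) +
    β * ∑ᶠ y : Y, J (w.next u y) * M.nextObsProb (M.filter ρ zstar w) u y

/-- `φ` is an optimal policy `φ^N` of the approximate finite model: it selects minimizers in the
fixed point equation `J(w) = min_u approxQ J w u` of the value function `J = J_β^N` (for
`0 ≤ β < 1` this equation has exactly one solution). -/
def IsApproxOptimal (M : POMDP X Y U) (β : ℝ) {N : ℕ} (ρ : Window Y U N → ProbabilityMeasure X)
    (zstar : ProbabilityMeasure X) (φ : Window Y U N → U) : Prop :=
  ∃ J : Window Y U N → ℝ, ∀ w : Window Y U N,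
    J w = M.approxQ β ρ zstar J w (φ w) ∧ ∀ u : U, J w ≤ M.approxQ β ρ zstar J w u

end

section

variable {X Y U : Type*} [MetricSpace X] [MeasurableSpace X] [MeasurableSpace Y]
  [MeasurableSpace U] [Finite Y] [MeasurableSingletonClass Y] [Finite U]
  [MeasurableSingletonClass U] [Nonempty U]

/-- The filter stability term `L̄_t^N`: the supremum over policies `γ` that are Markov in
`(ẑ_t, t)` of the expectation under `γ`, with prior `z`, of the Wasserstein distance between
`P^{z_t^-}(X_{t+N} ∈ · | Y_{[t,t+N]}, U_{[t,t+N-1]})` and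
`P^{zstar}(X_{t+N} ∈ · | Y_{[t,t+N]}, U_{[t,t+N-1]})`. -/
def stabilityTerm (M : POMDP X Y U) (N : ℕ) (ρ : Window Y U N → ProbabilityMeasure X)
    (z zstar : ProbabilityMeasure X) (t : ℕ) : ℝ≥0∞ :=
  ⨆ (γ : Policy Y U) (_ : M.IsWindowMarkov N z γ),
    ∫⁻ ω, wasserstein
      (M.filter ρ (M.predictor z t (fun i => (ω i).2.1) (fun i => (ω i).2.2))
        (windowAt N t ω) : Measure X)
      (M.filter ρ zstar (windowAt N t ω) : Measure X) ∂(M.pathLaw z γ)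

end

end POMDP

end

/-! Write w_t for the window at time t, z_t for the predictor, and let J be the fixed point of the
finite model. Put r_t = J(w_t) - c(X_{N+t}, U_{N+t}) - β J(w_{t+1}). The discounted sum of the r_t
telescopes to J(w_0) minus the discounted cost (`sum_residual`). Given the data up to U_{N+t} = u,
the state X_{N+t} has law ψ(z_t, w_t), so the conditional mean of r_t is J(w_t) - ∫ q dψ(z_t, w_t),
where q(x) = c(x, u) + β E[J(w_{t+1}) | x, u] (`integral_residual`). With ψ(z*, w_t) instead, the
Bellman equation makes this expression nonpositive for every action and zero for the action of φ.

The function q is Lipschitz with constant K = K₁ + αβ‖J‖, and ‖J‖ ≤ ‖c‖/(1-β). Hence replacing z_t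
by z* costs at most K times the W₁ gap of the two filters (`ofReal_setIntegral_residual_cylOf_le`).
So every policy costs at least J minus K times its discounted gaps, and φ costs at most J plus K
times its own; this is the factor 2.

The infimum in J* allows competitors that depend on the initial window and on the whole history,
whereas the stability terms are suprema of expectations over Γ̂. The gap depends on (z_t, w_t) only,
and this pair is a controlled Markov state. The worst discounted gap over k steps therefore solves a
dynamic programme (`worstGap`): it dominates the gaps of every policy, and it is attained by a
feedback in t and (z_t, w_t), which continues the given first N steps to a member of Γ̂
(`lintegral_worstGap_le_stabilityTerm`). The horizon k goes to infinity by monotone convergence.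

As Y and U are finite, all conditioning takes place on cylinders of finitely many observations and
actions, where the law of the state is an unnormalised recursive filter (`map_restrict_cyl`). -/

noncomputable section

/-! ### Data paths and cylinders -/

/-- The sequence of observations of a trajectory. -/
def obsOf {X Y U : Type*} (ω : ℕ → X × Y × U) : ℕ → Y := fun i => (ω i).2.1

/-- The sequence of actions of a trajectory. -/
def actOf {X Y U : Type*} (ω : ℕ → X × Y × U) : ℕ → U := fun i => (ω i).2.2

/-- The trajectories whose first `n` observations and actions are those of `y` and `u`. -/
def cyl {X Y U : Type*} (n : ℕ) (y : ℕ → Y) (u : ℕ → U) : Set (ℕ → X × Y × U) :=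
  {ω | ∀ i < n, (ω i).2.1 = y i ∧ (ω i).2.2 = u i}

/-- The policy `γ` prescribes the first `n` actions of `u` when the observations are `y`. -/
def Policy.Consistent {Y U : Type*} (γ : Policy Y U) (n : ℕ) (y : ℕ → Y) (u : ℕ → U) : Prop :=
  ∀ i < n, γ i (fun j => y j) (fun j => u j) = u i

theorem cyl_zero {X Y U : Type*} (y : ℕ → Y) (u : ℕ → U) :
    (cyl 0 y u : Set (ℕ → X × Y × U)) = Set.univ := by
  simp [cyl]

theorem cyl_succ {X Y U : Type*} (n : ℕ) (y : ℕ → Y) (u : ℕ → U) :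
    (cyl (n + 1) y u : Set (ℕ → X × Y × U)) =
      cyl n y u ∩ {ω | (ω n).2.1 = y n ∧ (ω n).2.2 = u n} := by
  ext ω
  simp only [cyl, Set.mem_ofPred_eq, Set.mem_inter_iff, Nat.lt_succ_iff_lt_or_eq]
  constructor
  · exact fun h => ⟨fun i hi => h i (Or.inl hi), h n (Or.inr rfl)⟩
  · rintro ⟨h₁, h₂⟩ i (hi | rfl)
    exacts [h₁ i hi, h₂]

theorem Policy.consistent_succ {Y U : Type*} (γ : Policy Y U) (n : ℕ) (y : ℕ → Y) (u : ℕ → U) :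
    γ.Consistent (n + 1) y u ↔
      γ.Consistent n y u ∧ γ n (fun j => y j) (fun j => u j) = u n := by
  simp only [Policy.Consistent, Nat.lt_succ_iff_lt_or_eq]
  constructor
  · exact fun h => ⟨fun i hi => h i (Or.inl hi), h n (Or.inr rfl)⟩
  · rintro ⟨h₁, h₂⟩ i (hi | rfl)
    exacts [h₁ i hi, h₂]

theorem measurableSet_cyl {X Y U : Type*} [MeasurableSpace X] [MeasurableSpace Y]
    [MeasurableSpace U] [MeasurableSingletonClass Y] [MeasurableSingletonClass U]
    (n : ℕ) (y : ℕ → Y) (u : ℕ → U) : MeasurableSet (cyl n y u : Set (ℕ → X × Y × U)) := by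
  have : (cyl n y u : Set (ℕ → X × Y × U)) =
      ⋂ i : ℕ, ⋂ _ : i < n, {ω | (ω i).2.1 = y i} ∩ {ω | (ω i).2.2 = u i} := by
    ext ω; simp [cyl]
  rw [this]
  refine MeasurableSet.iInter fun i => MeasurableSet.iInter fun _ => MeasurableSet.inter ?_ ?_
  · exact (measurable_pi_apply i).snd.fst (measurableSet_singleton (y i))
  · exact (measurable_pi_apply i).snd.snd (measurableSet_singleton (u i))

namespace POMDP

variable {X Y U : Type*} [MeasurableSpace X] [MeasurableSpace Y] [MeasurableSpace U]

/-! ### Unnormalised predictors and filters -/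

/-- The joint measure of the state and the event that `y` is observed. -/
def obsUpdate (M : POMDP X Y U) (y : Y) (μ : Measure X) : Measure X :=
  μ.withDensity fun x => M.channel x {y}

/-- The law of the next state under the action `u`. -/
def move (M : POMDP X Y U) (u : U) (μ : Measure X) : Measure X :=
  μ.bind fun x => M.transition (x, u)

/-- The unnormalised predictor: the joint measure of `X_n` and of the event that the first `n`
observations are those of `y`, when the actions `u` are played. -/
def upred (M : POMDP X Y U) (μ : Measure X) (y : ℕ → Y) (u : ℕ → U) : ℕ → Measure X
  | 0 => μ
  | n + 1 => M.move (u n) (M.obsUpdate (y n) (upred M μ y u n))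

/-- The unnormalised filter. -/
def ufilt (M : POMDP X Y U) (μ : Measure X) (y : ℕ → Y) (u : ℕ → U) (n : ℕ) : Measure X :=
  M.obsUpdate (y n) (M.upred μ y u n)

theorem measurable_transition (M : POMDP X Y U) (u : U) :
    Measurable fun x => M.transition (x, u) :=
  M.transition.measurable.comp (by fun_prop)

theorem measurable_channel [MeasurableSingletonClass Y] (M : POMDP X Y U) (y : Y) :
    Measurable fun x => M.channel x {y} :=
  M.channel.measurable_coe (measurableSet_singleton y)

theorem obsUpdate_smul (M : POMDP X Y U) (y : Y) (c : ℝ≥0∞) (μ : Measure X) :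
    M.obsUpdate y (c • μ) = c • M.obsUpdate y μ :=
  withDensity_smul_measure _ _

theorem move_smul (M : POMDP X Y U) (u : U) (c : ℝ≥0∞) (μ : Measure X) :
    M.move u (c • μ) = c • M.move u μ :=
  Measure.bind_smul _ _ _

theorem move_univ (M : POMDP X Y U) (u : U) (μ : Measure X) :
    M.move u μ Set.univ = μ Set.univ := by
  rw [move, Measure.bind_apply MeasurableSet.univ (M.measurable_transition u).aemeasurable]
  simp

theorem obsUpdate_apply_le (M : POMDP X Y U) (y : Y) (μ : Measure X) (s : Set X)
    (hs : MeasurableSet s) : M.obsUpdate y μ s ≤ μ s := by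
  rw [obsUpdate, withDensity_apply _ hs]
  calc _ ≤ ∫⁻ _ in s, 1 ∂μ := lintegral_mono fun x => prob_le_one
    _ = μ s := by simp

instance (M : POMDP X Y U) (y : Y) (μ : Measure X) [IsFiniteMeasure μ] :
    IsFiniteMeasure (M.obsUpdate y μ) :=
  ⟨(M.obsUpdate_apply_le y μ _ MeasurableSet.univ).trans_lt (measure_lt_top _ _)⟩

instance (M : POMDP X Y U) (u : U) (μ : Measure X) [IsFiniteMeasure μ] :
    IsFiniteMeasure (M.move u μ) :=
  ⟨by rw [move_univ]; exact measure_lt_top _ _⟩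

instance (M : POMDP X Y U) (μ : Measure X) [IsFiniteMeasure μ] (y : ℕ → Y) (u : ℕ → U) (n : ℕ) :
    IsFiniteMeasure (M.upred μ y u n) := by
  induction n with
  | zero => exact ‹IsFiniteMeasure μ›
  | succ n ih => unfold upred; infer_instance

instance (M : POMDP X Y U) (μ : Measure X) [IsFiniteMeasure μ] (y : ℕ → Y) (u : ℕ → U) (n : ℕ) :
    IsFiniteMeasure (M.ufilt μ y u n) := by
  unfold ufilt; infer_instance

/-- Both recursion steps are linear, so normalisation can be postponed to the end and a scalar in
the prior cancels there. -/
theorem upred_smul (M : POMDP X Y U) (c : ℝ≥0∞) (μ : Measure X) (y : ℕ → Y) (u : ℕ → U) (n : ℕ) :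
    M.upred (c • μ) y u n = c • M.upred μ y u n := by
  induction n with
  | zero => rfl
  | succ n ih => simp only [upred, ih, obsUpdate_smul, move_smul]

theorem ufilt_smul (M : POMDP X Y U) (c : ℝ≥0∞) (μ : Measure X) (y : ℕ → Y) (u : ℕ → U) (n : ℕ) :
    M.ufilt (c • μ) y u n = c • M.ufilt μ y u n := by
  simp only [ufilt, upred_smul, obsUpdate_smul]

/-- Flow property of the recursion; with linearity it lets a predictor serve as a new prior. -/
theorem upred_add (M : POMDP X Y U) (μ : Measure X) (y : ℕ → Y) (u : ℕ → U) (s n : ℕ) :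
    M.upred (M.upred μ y u s) (fun i => y (s + i)) (fun i => u (s + i)) n =
      M.upred μ y u (s + n) := by
  induction n with
  | zero => rfl
  | succ n ih => rw [upred, ih]; rfl

theorem ufilt_add (M : POMDP X Y U) (μ : Measure X) (y : ℕ → Y) (u : ℕ → U) (s n : ℕ) :
    M.ufilt (M.upred μ y u s) (fun i => y (s + i)) (fun i => u (s + i)) n =
      M.ufilt μ y u (s + n) := by
  simp only [ufilt, upred_add]

theorem upred_congr (M : POMDP X Y U) (μ : Measure X) {y y' : ℕ → Y} {u u' : ℕ → U} {n : ℕ}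
    (hy : ∀ i < n, y i = y' i) (hu : ∀ i < n, u i = u' i) :
    M.upred μ y u n = M.upred μ y' u' n := by
  induction n with
  | zero => rfl
  | succ n ih =>
    simp only [upred, ih (fun i hi => hy i (by omega)) (fun i hi => hu i (by omega)),
      hy n (by omega), hu n (by omega)]

theorem ufilt_congr (M : POMDP X Y U) (μ : Measure X) {y y' : ℕ → Y} {u u' : ℕ → U} {n : ℕ}
    (hy : ∀ i < n + 1, y i = y' i) (hu : ∀ i < n, u i = u' i) :
    M.ufilt μ y u n = M.ufilt μ y' u' n := by
  simp only [ufilt, M.upred_congr μ (fun i hi => hy i (by omega)) hu, hy n (by omega)]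

theorem upred_succ_univ (M : POMDP X Y U) (μ : Measure X) (y : ℕ → Y) (u : ℕ → U) (n : ℕ) :
    M.upred μ y u (n + 1) Set.univ = M.ufilt μ y u n Set.univ :=
  M.move_univ _ _

theorem lintegral_obsUpdate [MeasurableSingletonClass Y] (M : POMDP X Y U) (y : Y) (μ : Measure X)
    {f : X → ℝ≥0∞} (hf : Measurable f) :
    ∫⁻ x, f x ∂M.obsUpdate y μ = ∫⁻ x, M.channel x {y} * f x ∂μ := by
  rw [obsUpdate, lintegral_withDensity_eq_lintegral_mul _ (M.measurable_channel y) hf]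
  rfl

theorem lintegral_move (M : POMDP X Y U) (u : U) (μ : Measure X)
    {f : X → ℝ≥0∞} (hf : Measurable f) :
    ∫⁻ x, f x ∂M.move u μ = ∫⁻ x, ∫⁻ x', f x' ∂M.transition (x, u) ∂μ :=
  Measure.lintegral_bind (M.measurable_transition u).aemeasurable hf.aemeasurable

/-! ### The law of the trajectory on cylinders -/

variable [Finite Y] [MeasurableSingletonClass Y] [Finite U] [MeasurableSingletonClass U]

theorem map_pathLaw_zero (M : POMDP X Y U) (z : ProbabilityMeasure X) (γ : Policy Y U) :
    (M.pathLaw z γ).map (fun ω => ω 0) = M.initialLaw z γ := by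
  have h : (fun ω : ℕ → X × Y × U => ω 0) =
      (fun h : (_ : Finset.Iic 0) → X × Y × U => h ⟨0, by simp⟩) ∘ Preorder.frestrictLe 0 := rfl
  rw [h, ← Measure.map_map (by fun_prop) (by fun_prop), pathLaw, Kernel.trajMeasure,
    Measure.map_comp _ _ (by fun_prop), Kernel.traj_map_frestrictLe, Kernel.partialTraj_self,
    Measure.id_comp, Measure.map_map (by fun_prop) (by fun_prop)]
  exact Measure.map_id

theorem map_pathLaw_succ (M : POMDP X Y U) (z : ProbabilityMeasure X) (γ : Policy Y U) (n : ℕ) :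
    (M.pathLaw z γ).map (fun ω => (Preorder.frestrictLe (π := fun _ => X × Y × U) n ω, ω (n + 1))) =
      (M.pathLaw z γ).map (Preorder.frestrictLe (π := fun _ => X × Y × U) n) ⊗ₘ
        M.stepKernel γ n :=
  (Kernel.map_frestrictLe_trajMeasure_compProd_eq_map_trajMeasure
    (X := fun _ => X × Y × U)).symm

theorem lintegral_stepKernel (M : POMDP X Y U) (γ : Policy Y U) (n : ℕ)
    (h : (_ : Finset.Iic n) → X × Y × U) {f : X × Y × U → ℝ≥0∞} (hf : Measurable f) :
    ∫⁻ p, f p ∂M.stepKernel γ n h =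
      ∫⁻ x, ∫⁻ y, f (extend γ n (h, x, y)) ∂M.channel x
        ∂M.transition ((h ⟨n, Finset.mem_Iic.2 le_rfl⟩).1, (h ⟨n, Finset.mem_Iic.2 le_rfl⟩).2.2) := by
  have hm := measurable_extend (X := X) γ n
  rw [stepKernel, Kernel.lintegral_map _ hm _ hf, Kernel.lintegral_id_prod (f := fun a => f (extend γ n a)) (hf.comp hm),
    Kernel.comap_apply,
    Kernel.lintegral_compProd _ _ _ (f := fun b => f (extend γ n (h, b)))
      ((hf.comp hm).comp (by fun_prop))]
  rfl

theorem ae_action (M : POMDP X Y U) (z : ProbabilityMeasure X) (γ : Policy Y U) (n : ℕ) :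
    ∀ᵐ ω ∂M.pathLaw z γ, (ω n).2.2 = γ n (fun i => (ω i).2.1) (fun i => (ω i).2.2) := by
  cases n with
  | zero =>
    have hγ : Measurable (fun y : Y => γ 0 (fun _ => y) Fin.elim0) := measurable_of_countable _
    have h : ∀ᵐ p ∂(M.pathLaw z γ).map (fun ω => ω 0), p.2.2 = γ 0 (fun _ => p.2.1) Fin.elim0 := by
      rw [map_pathLaw_zero, initialLaw, ae_map_iff (measurable_initial γ).aemeasurable]
      · simp
      · exact measurableSet_eq_fun (by fun_prop) (hγ.comp (by fun_prop))
    have := ae_of_ae_map (measurable_pi_apply 0).aemeasurable h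
    filter_upwards [this] with ω hω
    rw [hω]
    congr 1
    · ext i; have hi : (i : ℕ) = 0 := by omega
      rw [hi]
    · ext i; exact i.elim0
  | succ n =>
    -- `F` recomputes the action from the past and the new observation. The step kernel is the image
    -- of a measure under `extend`, so it is carried by the graph of `F`.
    let F : (((_ : Finset.Iic n) → X × Y × U) × (X × Y × U)) → U :=
      fun q => (extend γ n (q.1, q.2.1, q.2.2.1)).2.2
    have hF : Measurable F := (measurable_extend (X := X) γ n).snd.snd.comp (by fun_prop)
    have hS : MeasurableSet {q : ((_ : Finset.Iic n) → X × Y × U) × (X × Y × U) |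
        q.2.2.2 = F q} := measurableSet_eq_fun (by fun_prop) hF
    have h : ∀ᵐ q ∂(M.pathLaw z γ).map
        (fun ω => (Preorder.frestrictLe (π := fun _ => X × Y × U) n ω, ω (n + 1))),
        q.2.2.2 = F q := by
      rw [map_pathLaw_succ, Measure.ae_compProd_iff hS]
      refine Filter.Eventually.of_forall fun h => ?_
      rw [stepKernel, Kernel.map_apply _ (measurable_extend γ n)]
      refine (ae_map_iff (measurable_extend γ n).aemeasurable (measurable_prodMk_left hS)).2 ?_
      rw [Kernel.prod_apply, Kernel.id_apply, Measure.dirac_prod]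
      refine (ae_map_iff (by fun_prop)
        (measurable_extend γ n (measurable_prodMk_left hS))).2 ?_
      exact Filter.Eventually.of_forall fun p => rfl
    have := ae_of_ae_map (by fun_prop) h
    filter_upwards [this] with ω hω
    rw [hω]
    simp only [F, extend]
    congr 1
    ext i
    split_ifs with hi
    · rfl
    · have : (i : ℕ) = n + 1 := by omega
      rw [this]

/-- Actions are deterministic functions of the data: once the observation at time n is fixed on the
cylinder, the action is too, almost surely. -/
theorem cyl_succ_ae_eq (M : POMDP X Y U) (z : ProbabilityMeasure X) (γ : Policy Y U) (n : ℕ)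
    (y : ℕ → Y) (u : ℕ → U) (hγ : γ n (fun j => y j) (fun j => u j) = u n) :
    (cyl (n + 1) y u : Set (ℕ → X × Y × U)) =ᵐ[M.pathLaw z γ]
      (cyl n y u ∩ {ω | (ω n).2.1 = y n} : Set (ℕ → X × Y × U)) := by
  filter_upwards [M.ae_action z γ n] with ω hω
  apply propext
  rw [cyl_succ]
  refine ⟨fun h => ⟨h.1, h.2.1⟩, fun h => ⟨h.1, h.2, ?_⟩⟩
  rw [hω, ← hγ]
  have hy : (ω n).2.1 = y n := h.2
  congr 1
  · ext i
    rcases Nat.lt_succ_iff_lt_or_eq.1 i.2 with hi | hi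
    · exact (h.1 i hi).1
    · rw [hi]; exact hy
  · ext i
    exact (h.1 i i.2).2

theorem cyl_succ_ae_eq_empty (M : POMDP X Y U) (z : ProbabilityMeasure X) (γ : Policy Y U) (n : ℕ)
    (y : ℕ → Y) (u : ℕ → U) (hγ : γ n (fun j => y j) (fun j => u j) ≠ u n) :
    (cyl (n + 1) y u : Set (ℕ → X × Y × U)) =ᵐ[M.pathLaw z γ] (∅ : Set (ℕ → X × Y × U)) := by
  filter_upwards [M.ae_action z γ n] with ω hω
  apply propext
  refine ⟨fun h => hγ ?_, fun h => h.elim⟩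
  rw [← (h n (by omega)).2, hω]
  congr 1
  · ext i
    exact (h i (by omega)).1.symm
  · ext i
    exact (h i (by omega)).2.symm

open Classical in
/-- The joint law of `X_n` and `Y_n` on a cylinder. -/
theorem map_restrict_cyl (M : POMDP X Y U) (z : ProbabilityMeasure X) (γ : Policy Y U) (n : ℕ)
    (y : ℕ → Y) (u : ℕ → U) :
    ((M.pathLaw z γ).restrict (cyl n y u)).map (fun ω => ((ω n).1, (ω n).2.1)) =
      if γ.Consistent n y u then M.upred z y u n ⊗ₘ M.channel else 0 := by
  induction n with
  | zero =>
    have hc : γ.Consistent 0 y u := by simp [Policy.Consistent]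
    have h : (fun ω : ℕ → X × Y × U => ((ω 0).1, (ω 0).2.1)) =
      (fun p : X × Y × U => (p.1, p.2.1)) ∘ (fun ω => ω 0) := rfl
    rw [cyl_zero, Measure.restrict_univ, if_pos hc, h, ← Measure.map_map (by fun_prop) (by fun_prop),
      map_pathLaw_zero, initialLaw, Measure.map_map (by fun_prop) (measurable_initial γ)]
    exact Measure.map_id
  | succ n ih =>
    have hC := measurableSet_cyl (X := X) (n + 1) y u
    refine Measure.ext_of_lintegral _ fun g hg => ?_
    -- Mean of g at time n + 1 from state x at time n under the action `u n`. By the Markov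
    -- property, g may be replaced by `G` of the state at time n, and the induction hypothesis
    -- applies.
    let G : X → ℝ≥0∞ := fun x => ∫⁻ x', ∫⁻ y', g (x', y') ∂M.channel x' ∂M.transition (x, u n)
    have hG' : Measurable fun x' => ∫⁻ y', g (x', y') ∂M.channel x' := hg.lintegral_kernel_prod_right'
    have hG : Measurable G := by
      have := (hG'.lintegral_kernel (κ := M.transition))
      exact this.comp (by fun_prop)
    have h₁ : ∫⁻ ω in cyl (n + 1) y u, g ((ω (n + 1)).1, (ω (n + 1)).2.1) ∂M.pathLaw z γ =
        ∫⁻ ω in cyl (n + 1) y u, G (ω n).1 ∂M.pathLaw z γ := by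
      let S : Set ((_ : Finset.Iic n) → X × Y × U) :=
        {h | ∀ i : Finset.Iic n, (h i).2.1 = y i ∧ (h i).2.2 = u i}
      have hS : MeasurableSet S := by
        have : S = ⋂ i : Finset.Iic n, {h | (h i).2.1 = y i} ∩ {h | (h i).2.2 = u i} := by
          ext h; simp [S]
        rw [this]
        refine MeasurableSet.iInter fun i => MeasurableSet.inter ?_ ?_
        · exact (measurable_pi_apply i).snd.fst (measurableSet_singleton (y i))
        · exact (measurable_pi_apply i).snd.snd (measurableSet_singleton (u i))
      have hSC : Preorder.frestrictLe (π := fun _ => X × Y × U) n ⁻¹' S = cyl (n + 1) y u := by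
        ext ω
        simp only [S, cyl, Set.mem_preimage, Set.mem_ofPred_eq, Preorder.frestrictLe_apply,
          Subtype.forall, Finset.mem_Iic, Nat.lt_succ_iff]
      have hgm : Measurable fun p : X × Y × U => g (p.1, p.2.1) := hg.comp (by fun_prop)
      have e := congrArg (fun μ => ∫⁻ q, S.indicator (fun _ => g (q.2.1, q.2.2.1)) q.1 ∂μ)
        (M.map_pathLaw_succ z γ n)
      have hm : Measurable fun q : ((_ : Finset.Iic n) → X × Y × U) × (X × Y × U) =>
          S.indicator (fun _ => g (q.2.1, q.2.2.1)) q.1 := by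
        have : (fun q : ((_ : Finset.Iic n) → X × Y × U) × (X × Y × U) =>
          S.indicator (fun _ => g (q.2.1, q.2.2.1)) q.1) =
          (Prod.fst ⁻¹' S).indicator (fun q => g (q.2.1, q.2.2.1)) := by
            ext q; simp [Set.indicator]
        rw [this]
        exact (hg.comp (by fun_prop)).indicator (measurable_fst hS)
      rw [lintegral_map hm (by fun_prop), Measure.lintegral_compProd hm] at e
      rw [lintegral_map hm.lintegral_kernel_prod_right' (by fun_prop)] at e
      rw [← lintegral_indicator hC, ← lintegral_indicator hC]
      convert e using 2
      · ext ω
        rw [← hSC]; simp [Set.indicator]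
      · ext ω
        by_cases hω : ω ∈ cyl (n + 1) y u
        · have hω' : Preorder.frestrictLe (π := fun _ => X × Y × U) n ω ∈ S := by
            rw [← hSC] at hω; exact hω
          simp only [Set.indicator_of_mem hω, Set.indicator_of_mem hω']
          rw [M.lintegral_stepKernel γ n _ hgm]
          simp only [G, extend, Preorder.frestrictLe_apply, (hω n (by omega)).2]
        · have hω' : Preorder.frestrictLe (π := fun _ => X × Y × U) n ω ∉ S := by
            rw [← hSC] at hω; exact hω
          simp [Set.indicator_of_notMem hω, Set.indicator_of_notMem hω']
    rw [lintegral_map hg (by fun_prop), h₁]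
    -- If the prescribed action differs from `u n`, the cylinder is null and both sides vanish.
    by_cases hγ : γ n (fun j => y j) (fun j => u j) = u n
    · have hae := M.cyl_succ_ae_eq z γ n y u hγ
      have hSy : MeasurableSet {ω : ℕ → X × Y × U | (ω n).2.1 = y n} :=
        (measurable_pi_apply n).snd.fst (measurableSet_singleton (y n))
      rw [setLIntegral_congr hae, Set.inter_comm,
        ← Measure.restrict_restrict hSy]
      have h₂ : ∫⁻ ω in {ω | (ω n).2.1 = y n}, G (ω n).1 ∂(M.pathLaw z γ).restrict (cyl n y u) =
          ∫⁻ p in Prod.snd ⁻¹' {y n}, G p.1 ∂((M.pathLaw z γ).restrict (cyl n y u)).map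
            (fun ω => ((ω n).1, (ω n).2.1)) := by
        rw [setLIntegral_map (measurable_snd (measurableSet_singleton _)) (by fun_prop)
          (by fun_prop)]
        rfl
      refine h₂.trans ?_
      rw [ih]
      by_cases hc : γ.Consistent n y u
      · rw [if_pos hc, if_pos ((γ.consistent_succ n y u).2 ⟨hc, hγ⟩),
          ← lintegral_indicator (measurable_snd (measurableSet_singleton _)),
          Measure.lintegral_compProd
            (f := (Prod.snd ⁻¹' {y n}).indicator fun p => G p.1) ((hG.comp measurable_fst).indicator
            (measurable_snd (measurableSet_singleton _))),
          Measure.lintegral_compProd hg, upred, lintegral_move _ _ _ hG',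
          lintegral_obsUpdate _ _ _ hG]
        refine lintegral_congr fun x => ?_
        have : (fun b => (Prod.snd ⁻¹' {y n}).indicator (fun p : X × Y => G p.1) (x, b)) =
            ({y n} : Set Y).indicator fun _ => G x := by
          ext b; simp [Set.indicator]
        rw [this, lintegral_indicator_const (measurableSet_singleton _), mul_comm]
      · rw [if_neg hc, if_neg (fun h => hc ((γ.consistent_succ n y u).1 h).1)]
        simp
    · have hae := M.cyl_succ_ae_eq_empty z γ n y u hγ
      rw [setLIntegral_congr hae, if_neg (fun h => hγ ((γ.consistent_succ n y u).1 h).2)]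
      simp

open Classical in
theorem map_state_restrict_cyl (M : POMDP X Y U) (z : ProbabilityMeasure X) (γ : Policy Y U)
    (n : ℕ) (y : ℕ → Y) (u : ℕ → U) :
    ((M.pathLaw z γ).restrict (cyl n y u)).map (fun ω => (ω n).1) =
      if γ.Consistent n y u then M.upred z y u n else 0 := by
  have h := congrArg Measure.fst (M.map_restrict_cyl z γ n y u)
  rw [Measure.fst, Measure.map_map (by fun_prop) (by fun_prop)] at h
  refine h.trans ?_
  split_ifs <;> simp

open Classical in
theorem pathLaw_cyl (M : POMDP X Y U) (z : ProbabilityMeasure X) (γ : Policy Y U)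
    (n : ℕ) (y : ℕ → Y) (u : ℕ → U) :
    M.pathLaw z γ (cyl n y u) =
      if γ.Consistent n y u then M.upred z y u n Set.univ else 0 := by
  have h := congrArg (fun μ => μ Set.univ) (M.map_state_restrict_cyl z γ n y u)
  rw [Measure.map_apply (by fun_prop) MeasurableSet.univ] at h
  simp only [Set.preimage_univ, Measure.restrict_apply_univ] at h
  rw [h]
  split_ifs <;> simp

-- The observation at time n is fixed but the action at time n is not, as in the definition of ψ,
-- whose window has one more observation than actions.
open Classical in
theorem map_state_restrict_obs (M : POMDP X Y U) (z : ProbabilityMeasure X) (γ : Policy Y U)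
    (n : ℕ) (y : ℕ → Y) (u : ℕ → U) :
    ((M.pathLaw z γ).restrict (cyl n y u ∩ {ω | (ω n).2.1 = y n})).map (fun ω => (ω n).1) =
      if γ.Consistent n y u then M.ufilt z y u n else 0 := by
  have hSy : MeasurableSet {ω : ℕ → X × Y × U | (ω n).2.1 = y n} :=
    (measurable_pi_apply n).snd.fst (measurableSet_singleton (y n))
  ext s hs
  have h := congrArg (fun μ => μ (s ×ˢ {y n})) (M.map_restrict_cyl z γ n y u)
  rw [Measure.map_apply (by fun_prop) (hs.prod (measurableSet_singleton _)),
    Measure.restrict_apply ((hs.prod (measurableSet_singleton _)).preimage (by fun_prop))] at h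
  rw [Measure.map_apply (by fun_prop) hs, Measure.restrict_apply (hs.preimage (by fun_prop))]
  have e : (fun ω : ℕ → X × Y × U => (ω n).1) ⁻¹' s ∩ (cyl n y u ∩ {ω | (ω n).2.1 = y n}) =
      (fun ω => ((ω n).1, (ω n).2.1)) ⁻¹' s ×ˢ {y n} ∩ cyl n y u := by
    ext ω
    simp only [Set.mem_inter_iff, Set.mem_preimage, Set.mem_prod, Set.mem_singleton_iff,
      Set.mem_ofPred_eq]
    tauto
  rw [e, h]
  split_ifs
  · rw [Measure.compProd_apply_prod hs (measurableSet_singleton _), ufilt, obsUpdate,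
      withDensity_apply _ hs]
  · simp

open Classical in
theorem map_state_restrict_cyl_succ (M : POMDP X Y U) (z : ProbabilityMeasure X) (γ : Policy Y U)
    (n : ℕ) (y : ℕ → Y) (u : ℕ → U) :
    ((M.pathLaw z γ).restrict (cyl (n + 1) y u)).map (fun ω => (ω n).1) =
      if γ.Consistent (n + 1) y u then M.ufilt z y u n else 0 := by
  by_cases hγ : γ n (fun j => y j) (fun j => u j) = u n
  · rw [Measure.restrict_congr_set (M.cyl_succ_ae_eq z γ n y u hγ), map_state_restrict_obs]
    simp only [Policy.consistent_succ, hγ, and_true]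
  · rw [Measure.restrict_congr_set (M.cyl_succ_ae_eq_empty z γ n y u hγ)]
    simp [Policy.consistent_succ, hγ]

open Classical in
theorem map_obs_restrict_cyl_succ (M : POMDP X Y U) (z : ProbabilityMeasure X) (γ : Policy Y U)
    (n : ℕ) (y : ℕ → Y) (u : ℕ → U) :
    ((M.pathLaw z γ).restrict (cyl (n + 1) y u)).map (fun ω => (ω (n + 1)).2.1) =
      if γ.Consistent (n + 1) y u then
        (M.ufilt z y u n).bind fun x => (M.channel ∘ₖ M.transition) (x, u n)
      else 0 := by
  have h := congrArg Measure.snd (M.map_restrict_cyl z γ (n + 1) y u)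
  rw [Measure.snd, Measure.map_map (by fun_prop) (by fun_prop)] at h
  refine h.trans ?_
  split_ifs
  · rw [Measure.snd_compProd, upred, move, ufilt]
    ext s hs
    have hm : Measurable fun x => (M.channel ∘ₖ M.transition) (x, u n) :=
      (M.channel ∘ₖ M.transition).measurable.comp (by fun_prop)
    rw [Measure.bind_apply hs M.channel.aemeasurable, Measure.bind_apply hs hm.aemeasurable,
      Measure.lintegral_bind (M.measurable_transition (u n)).aemeasurable
        (M.channel.measurable_coe hs).aemeasurable]
    simp only [Kernel.comp_apply' _ _ _ hs]
  · simp

end POMDP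

/-- The normalisation of a measure. -/
def normed {X : Type*} [MeasurableSpace X] (μ : Measure X) : Measure X := (μ Set.univ)⁻¹ • μ

theorem normed_smul {X : Type*} [MeasurableSpace X] (μ : Measure X) {c : ℝ≥0∞} (h₀ : c ≠ 0)
    (h₁ : c ≠ ∞) : normed (c • μ) = normed μ := by
  rw [normed, normed, smul_smul, Measure.smul_apply, smul_eq_mul,
    ENNReal.mul_inv (Or.inl h₀) (Or.inl h₁), mul_right_comm, ENNReal.inv_mul_cancel h₀ h₁, one_mul]

theorem smul_normed {X : Type*} [MeasurableSpace X] (μ : Measure X) [IsFiniteMeasure μ] :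
    μ Set.univ • normed μ = μ := by
  by_cases h : μ Set.univ = 0
  · rw [Measure.measure_univ_eq_zero.1 h]; simp
  · rw [normed, smul_smul, ENNReal.mul_inv_cancel h (measure_ne_top _ _), one_smul]

theorem Policy.consistent_withPrefix {Y U : Type*} (γ : Policy Y U) {n k : ℕ} (hnk : n ≤ k)
    (y : ℕ → Y) (u : ℕ → U) : (Policy.withPrefix (fun i : Fin k => u i) γ).Consistent n y u := by
  intro i hi
  simp [Policy.withPrefix, hi.trans_le hnk]

namespace POMDP

variable {X Y U : Type*} [MeasurableSpace X] [MeasurableSpace Y] [MeasurableSpace U]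

/-! ### Conditional laws as normalised recursive filters -/

theorem ufilt_univ_le (M : POMDP X Y U) (μ : Measure X) (y : ℕ → Y) (u : ℕ → U) (n : ℕ) :
    M.ufilt μ y u n Set.univ ≤ M.upred μ y u n Set.univ :=
  M.obsUpdate_apply_le _ _ _ MeasurableSet.univ

/-- By linearity the zero measure stays zero, so a history of positive likelihood has prefixes of
positive likelihood. -/
theorem upred_univ_ne_zero (M : POMDP X Y U) (μ : Measure X) (y : ℕ → Y) (u : ℕ → U) (s n : ℕ)
    (h : M.upred μ y u (s + n) Set.univ ≠ 0) : M.upred μ y u s Set.univ ≠ 0 := by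
  intro h0
  rw [← upred_add, Measure.measure_univ_eq_zero.1 h0, ← zero_smul ℝ≥0∞ μ, upred_smul] at h
  simp at h

variable [Finite Y] [MeasurableSingletonClass Y] [Finite U] [MeasurableSingletonClass U]

theorem ae_withPrefix (M : POMDP X Y U) (z : ProbabilityMeasure X) (γ : Policy Y U) {k : ℕ}
    (u : Fin k → U) :
    ∀ᵐ ω ∂M.pathLaw z (Policy.withPrefix u γ), ∀ i : Fin k, (ω i).2.2 = u i := by
  refine ae_all_iff.2 fun i => ?_
  filter_upwards [M.ae_action z (Policy.withPrefix u γ) i] with ω hω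
  rw [hω]
  simp [Policy.withPrefix]

/-- The first n actions are played open loop, so conditioning on observations alone is conditioning
on the cylinder. -/
theorem obsEvent_ae_eq_cyl (M : POMDP X Y U) (z : ProbabilityMeasure X) (γ : Policy Y U) (n : ℕ)
    (y : ℕ → Y) (u : ℕ → U) :
    (obsEvent (fun i : Fin n => y i) : Set (ℕ → X × Y × U))
      =ᵐ[M.pathLaw z (Policy.withPrefix (fun i : Fin n => u i) γ)] cyl n y u := by
  filter_upwards [M.ae_withPrefix z γ (fun i : Fin n => u i)] with ω hω
  exact propext ⟨fun h i hi => ⟨h ⟨i, hi⟩, hω ⟨i, hi⟩⟩, fun h i => (h i i.2).1⟩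

theorem obsEvent_succ_ae_eq (M : POMDP X Y U) (z : ProbabilityMeasure X) (γ : Policy Y U) (n : ℕ)
    (y : ℕ → Y) (u : ℕ → U) :
    (obsEvent (fun i : Fin (n + 1) => y i) : Set (ℕ → X × Y × U))
      =ᵐ[M.pathLaw z (Policy.withPrefix (fun i : Fin n => u i) γ)]
        (cyl n y u ∩ {ω | (ω n).2.1 = y n} : Set (ℕ → X × Y × U)) := by
  filter_upwards [M.ae_withPrefix z γ (fun i : Fin n => u i)] with ω hω
  refine propext ⟨fun h => ⟨fun i hi => ⟨h ⟨i, by omega⟩, hω ⟨i, hi⟩⟩, h ⟨n, by omega⟩⟩,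
    fun h i => ?_⟩
  rcases Nat.lt_succ_iff_lt_or_eq.1 i.2 with hi | hi
  · exact (h.1 i hi).1
  · change (ω i).2.1 = y i
    rw [hi]; exact h.2

variable [Nonempty U]

/-- The event matters only up to null sets, which allows a cylinder for E; positive mass of ν
excludes the default value `d`. -/
theorem condState_eq (M : POMDP X Y U) (z : ProbabilityMeasure X) {n k : ℕ} (m : ℕ)
    (y : Fin n → Y) (u : Fin k → U) (d : ProbabilityMeasure X) (E : Set (ℕ → X × Y × U))
    (hE : obsEvent y =ᵐ[M.openLoopLaw z u] E) (ν : Measure X)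
    (hν : ((M.openLoopLaw z u).restrict E).map (fun ω => (ω m).1) = ν) (h0 : ν Set.univ ≠ 0) :
    (M.condState z m y u d : Measure X) = normed ν := by
  have hu : ν Set.univ = M.openLoopLaw z u (obsEvent y) := by
    rw [← hν, Measure.map_apply (by fun_prop) MeasurableSet.univ, measure_congr hE]
    simp
  have h1 : M.openLoopLaw z u (obsEvent y) ≠ 0 := hu ▸ h0
  rw [condState, dif_neg h1]
  change ((M.openLoopLaw z u)[|obsEvent y]).map (fun ω => (ω m).1) = normed ν
  rw [ProbabilityTheory.cond, Measure.restrict_congr_set hE, Measure.map_smul, hν, ← hu, normed]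

theorem predictor_eq (M : POMDP X Y U) (z : ProbabilityMeasure X) (t : ℕ) (y : ℕ → Y) (u : ℕ → U)
    (h : M.upred z y u t Set.univ ≠ 0) :
    (M.predictor z t (fun i => y i) (fun i => u i) : Measure X) = normed (M.upred z y u t) := by
  classical
  refine M.condState_eq z t _ _ _ _ (M.obsEvent_ae_eq_cyl z _ t y u) _ ?_ h
  rw [openLoopLaw, map_state_restrict_cyl, if_pos (Policy.consistent_withPrefix _ le_rfl y u)]

theorem filter_eq (M : POMDP X Y U) (z : ProbabilityMeasure X) {N : ℕ}
    (ρ : Window Y U N → ProbabilityMeasure X) (y : ℕ → Y) (u : ℕ → U)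
    (h : M.ufilt z y u N Set.univ ≠ 0) :
    (M.filter ρ z (fun i => y i, fun i => u i) : Measure X) = normed (M.ufilt z y u N) := by
  classical
  refine M.condState_eq z N _ _ _ _ (M.obsEvent_succ_ae_eq z _ N y u) _ ?_ h
  rw [openLoopLaw, map_state_restrict_obs, if_pos (Policy.consistent_withPrefix _ le_rfl y u)]

/-- The window filter started from the predictor is the filter of the whole history. -/
theorem filter_predictor (M : POMDP X Y U) (z : ProbabilityMeasure X) {N : ℕ}
    (ρ : Window Y U N → ProbabilityMeasure X) (t : ℕ) (y : ℕ → Y) (u : ℕ → U)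
    (h : M.ufilt z y u (t + N) Set.univ ≠ 0) :
    (M.filter ρ (M.predictor z t (fun i => y i) (fun i => u i))
      (fun i => y (t + i), fun i => u (t + i)) : Measure X) = normed (M.ufilt z y u (t + N)) := by
  have h' : M.upred z y u t Set.univ ≠ 0 :=
    M.upred_univ_ne_zero _ _ _ t N fun h0 => h (le_antisymm (h0 ▸ M.ufilt_univ_le _ _ _ _) bot_le)
  have hc : (M.upred z y u t Set.univ)⁻¹ ≠ 0 := ENNReal.inv_ne_zero.2 (measure_ne_top _ _)
  have hc' : (M.upred z y u t Set.univ)⁻¹ ≠ ∞ := ENNReal.inv_ne_top.2 h'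
  -- The predictor is the unnormalised predictor divided by its mass. Linearity takes this constant
  -- out, the flow property continues to time t + N, and the final normalisation removes the
  -- constant.
  have key : M.ufilt (M.predictor z t (fun i => y i) (fun i => u i) : Measure X)
      (fun i => y (t + i)) (fun i => u (t + i)) N =
      (M.upred z y u t Set.univ)⁻¹ • M.ufilt z y u (t + N) := by
    rw [M.predictor_eq z t y u h', normed, ufilt_smul, ufilt_add]
  rw [M.filter_eq _ ρ (fun i => y (t + i)) (fun i => u (t + i)), key, normed_smul _ hc hc']
  rw [key, Measure.smul_apply, smul_eq_mul]
  exact mul_ne_zero hc h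

/-- The past enters the new predictor only through the old one and the pair at time t; this is what
makes predictor and window together a controlled Markov state. -/
theorem predictor_succ (M : POMDP X Y U) (z : ProbabilityMeasure X) (t : ℕ) (y : ℕ → Y) (u : ℕ → U)
    (h : M.upred z y u (t + 1) Set.univ ≠ 0) :
    M.predictor z (t + 1) (fun i => y i) (fun i => u i) =
      M.predictor (M.predictor z t (fun i => y i) (fun i => u i)) 1 (fun _ => y t)
        (fun _ => u t) := by
  have h' : M.upred z y u t Set.univ ≠ 0 := M.upred_univ_ne_zero _ _ _ t 1 h
  have hc : (M.upred z y u t Set.univ)⁻¹ ≠ 0 := ENNReal.inv_ne_zero.2 (measure_ne_top _ _)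
  have hc' : (M.upred z y u t Set.univ)⁻¹ ≠ ∞ := ENNReal.inv_ne_top.2 h'
  have key : M.upred (M.predictor z t (fun i => y i) (fun i => u i) : Measure X)
      (fun i => y (t + i)) (fun i => u (t + i)) 1 =
      (M.upred z y u t Set.univ)⁻¹ • M.upred z y u (t + 1) := by
    rw [M.predictor_eq z t y u h', normed, upred_smul, upred_add]
  have e := M.predictor_eq (M.predictor z t (fun i => y i) (fun i => u i)) 1
    (fun i => y (t + i)) (fun i => u (t + i)) (by
      rw [key, Measure.smul_apply, smul_eq_mul]
      exact mul_ne_zero hc h)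
  rw [key, normed_smul _ hc hc'] at e
  refine Subtype.ext ?_
  refine (M.predictor_eq z (t + 1) y u h).trans (e.symm.trans ?_)
  have h₀ : ∀ i : Fin 1, t + (i : ℕ) = t := fun i => by omega
  simp only [h₀]
  rfl

end POMDP

/-! ### Integrals and distances of measures -/

theorem bddAbove_tvDist {X : Type*} [MeasurableSpace X] (μ ν : Measure X) [IsProbabilityMeasure μ]
    [IsProbabilityMeasure ν] :
    BddAbove (Set.range fun B : {B : Set X // MeasurableSet B} => |μ.real B.1 - ν.real B.1|) := by
  refine ⟨1, ?_⟩
  rintro _ ⟨B, rfl⟩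
  have h₁ := measureReal_le_one (μ := μ) (s := B.1)
  have h₂ := measureReal_le_one (μ := ν) (s := B.1)
  have h₃ : 0 ≤ μ.real B.1 := measureReal_nonneg
  have h₄ : 0 ≤ ν.real B.1 := measureReal_nonneg
  exact abs_le.2 ⟨by linarith, by linarith⟩

/-- Layer cake for f + B, whose values lie in [0, 2B]: at each level the two measures of the
superlevel set differ by at most half of `tvDist`, and the levels have total length 2B. -/
theorem integral_sub_integral_le_tvDist {X : Type*} [MeasurableSpace X] (μ ν : Measure X)
    [IsProbabilityMeasure μ] [IsProbabilityMeasure ν] {f : X → ℝ} (hf : Measurable f) {B : ℝ}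
    (hB : ∀ x, |f x| ≤ B) : |∫ x, f x ∂μ - ∫ x, f x ∂ν| ≤ B * tvDist μ ν := by
  obtain ⟨x₀⟩ : Nonempty X := nonempty_of_isProbabilityMeasure μ
  have hB0 : 0 ≤ B := (abs_nonneg _).trans (hB x₀)
  let g : X → ℝ := fun x => f x + B
  have hg : Measurable g := hf.add_const B
  have hint : ∀ (κ : Measure X) [IsProbabilityMeasure κ], Integrable f κ := fun κ _ =>
    Integrable.of_bound hf.aestronglyMeasurable B (Filter.Eventually.of_forall hB)
  have hlc : ∀ (κ : Measure X) [IsProbabilityMeasure κ],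
      ∫ x, f x ∂κ + B = ∫ t in Set.Ioc 0 (2 * B), κ.real {a | t ≤ g a} := by
    intro κ _
    have hgi : Integrable g κ := (hint κ).add (integrable_const B)
    rw [← hgi.integral_eq_integral_Ioc_meas_le
      (Filter.Eventually.of_forall fun x => ?_) (Filter.Eventually.of_forall fun x => ?_),
      integral_add (hint κ) (integrable_const B)]
    · simp
    · have := (abs_le.1 (hB x)).1
      simp only [Pi.zero_apply, g]; linarith
    · have := (abs_le.1 (hB x)).2
      simp only [g]; linarith
  have hti : ∀ (κ : Measure X) [IsProbabilityMeasure κ],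
      Integrable (fun t : ℝ => κ.real {a | t ≤ g a}) (volume.restrict (Set.Ioc 0 (2 * B))) := by
    intro κ _
    have hanti : Antitone fun t : ℝ => κ.real {a | t ≤ g a} := fun s t hst =>
      measureReal_mono fun a (ha : t ≤ g a) => hst.trans ha
    refine Integrable.of_bound hanti.measurable.aestronglyMeasurable 1
      (Filter.Eventually.of_forall fun t => ?_)
    rw [Real.norm_of_nonneg measureReal_nonneg]
    exact measureReal_le_one
  have e : ∫ x, f x ∂μ - ∫ x, f x ∂ν =
      ∫ t in Set.Ioc 0 (2 * B), (μ.real {a | t ≤ g a} - ν.real {a | t ≤ g a}) := by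
    rw [integral_sub (hti μ) (hti ν), ← hlc μ, ← hlc ν]; ring
  rw [e, tvDist, ← Real.norm_eq_abs]
  refine (norm_setIntegral_le_of_norm_le_const measure_Ioc_lt_top
    (C := ⨆ B : {B : Set X // MeasurableSet B}, |μ.real B.1 - ν.real B.1|) fun t _ => ?_).trans ?_
  · rw [Real.norm_eq_abs]
    exact le_ciSup (bddAbove_tvDist μ ν) ⟨{a | t ≤ g a}, measurableSet_le measurable_const hg⟩
  · rw [Real.volume_real_Ioc_of_le (by linarith)]
    apply le_of_eq; ring

/-- Test the supremum with f / K; boundedness gives the integrability that it demands. For K = 0 the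
function is constant, and the left side is 0 even if the distance is infinite. -/
theorem integral_sub_integral_le_wasserstein {X : Type*} [MetricSpace X] [MeasurableSpace X]
    [BorelSpace X] [SecondCountableTopology X] (μ ν : Measure X)
    [IsProbabilityMeasure μ] [IsProbabilityMeasure ν] {f : X → ℝ} {K C : ℝ} (hK : 0 ≤ K)
    (hf : ∀ x x', |f x - f x'| ≤ K * dist x x') (hC : ∀ x, |f x| ≤ C) :
    ENNReal.ofReal (∫ x, f x ∂μ - ∫ x, f x ∂ν) ≤ ENNReal.ofReal K * wasserstein μ ν := by
  rcases hK.eq_or_lt with rfl | hK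
  · obtain ⟨x₀⟩ : Nonempty X := nonempty_of_isProbabilityMeasure μ
    have hconst : f = fun _ => f x₀ := by
      ext x
      have := hf x x₀
      rw [zero_mul] at this
      exact sub_eq_zero.1 (abs_eq_zero.1 (le_antisymm this (abs_nonneg _)))
    rw [hconst]
    simp
  · have hL : LipschitzWith 1 fun x => K⁻¹ * f x := by
      refine LipschitzWith.of_dist_le_mul fun x x' => ?_
      rw [Real.dist_eq, ← mul_sub, abs_mul, abs_of_pos (inv_pos.2 hK), NNReal.coe_one, one_mul,
        inv_mul_le_iff₀ hK]
      exact hf x x'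
    have hm : Measurable fun x => K⁻¹ * f x := hL.continuous.measurable
    have hi : ∀ (κ : Measure X) [IsProbabilityMeasure κ], Integrable (fun x => K⁻¹ * f x) κ := by
      intro κ _
      refine Integrable.of_bound hm.aestronglyMeasurable (K⁻¹ * C)
        (Filter.Eventually.of_forall fun x => ?_)
      rw [Real.norm_eq_abs, abs_mul, abs_of_pos (inv_pos.2 hK)]
      exact mul_le_mul_of_nonneg_left (hC x) (inv_pos.2 hK).le
    have h : ENNReal.ofReal (∫ x, K⁻¹ * f x ∂μ - ∫ x, K⁻¹ * f x ∂ν) ≤ wasserstein μ ν := by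
      unfold wasserstein
      exact le_iSup₂_of_le (fun x => K⁻¹ * f x) hL (le_iSup₂_of_le (hi μ) (hi ν) le_rfl)
    refine le_trans (le_of_eq ?_) (mul_le_mul_right h _)
    rw [← ENNReal.ofReal_mul hK.le, integral_const_mul, integral_const_mul, ← mul_sub,
      mul_inv_cancel_left₀ hK.ne']

theorem abs_integral_le_of_forall {Y : Type*} [MeasurableSpace Y] (κ : Measure Y) [IsProbabilityMeasure κ] {f : Y → ℝ} {B : ℝ}
    (hf : ∀ y, |f y| ≤ B) : |∫ y, f y ∂κ| ≤ B := by
  have := norm_integral_le_of_norm_le_const (μ := κ) (f := f) (C := B)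
    (Filter.Eventually.of_forall hf)
  simpa using this

namespace POMDP

variable {X Y U : Type*} [MeasurableSpace X] [MeasurableSpace Y] [MeasurableSpace U]

/-- The integrand of the Bellman operator of the finite model: the cost of `u` at `x` plus the
discounted expectation of `J` at the window that follows `w`. -/
def qfun (M : POMDP X Y U) (β : ℝ) {N : ℕ} (J : Window Y U N → ℝ) (w : Window Y U N) (u : U)
    (x : X) : ℝ :=
  M.cost x u + β * ∫ y, J (w.next u y) ∂(M.channel ∘ₖ M.transition) (x, u)

theorem abs_qfun_le (M : POMDP X Y U) {β C B : ℝ} (hβ : 0 ≤ β)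
    (hC : ∀ (x : X) (u : U), |M.cost x u| ≤ C)
    {N : ℕ} {J : Window Y U N → ℝ} (hJ : ∀ w, |J w| ≤ B) (w : Window Y U N) (u : U) (x : X) :
    |M.qfun β J w u x| ≤ C + β * B := by
  refine (abs_add_le _ _).trans (add_le_add (hC x u) ?_)
  rw [abs_mul, abs_of_nonneg hβ]
  exact mul_le_mul_of_nonneg_left (abs_integral_le_of_forall _ fun y => hJ _) hβ

variable [Finite Y] [MeasurableSingletonClass Y]

theorem integral_eq_finsum_real (κ : Measure Y) [IsFiniteMeasure κ] (f : Y → ℝ) :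
    ∫ y, f y ∂κ = ∑ᶠ y, f y * κ.real {y} := by
  have := Fintype.ofFinite Y
  rw [integral_fintype (.of_finite), finsum_eq_sum_of_fintype]
  simp [mul_comm]

theorem measurable_integral_comp (M : POMDP X Y U) (u : U) (f : Y → ℝ) :
    Measurable fun x => ∫ y, f y ∂(M.channel ∘ₖ M.transition) (x, u) := by
  have hf : StronglyMeasurable f := (measurable_of_countable f).stronglyMeasurable
  have h := hf.integral_kernel (κ := M.channel ∘ₖ M.transition)
  exact h.measurable.comp (by fun_prop : Measurable fun x : X => (x, u))

theorem integral_comp_eq (M : POMDP X Y U) (p : X × U) (f : Y → ℝ) :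
    ∫ y, f y ∂(M.channel ∘ₖ M.transition) p = ∫ x, ∫ y, f y ∂M.channel x ∂M.transition p :=
  Kernel.integral_comp (.of_finite)

/-- Averaging J over the channel first gives a function of the next state bounded by B. Only the
transition then depends on x, so its total variation modulus suffices and the channel needs no
regularity. -/
theorem abs_qfun_sub_le {X : Type*} [MetricSpace X] [MeasurableSpace X] (M : POMDP X Y U) {β α K₁ B : ℝ} (hβ : 0 ≤ β)
    (hT : ∀ (x x' : X) (u : U),
      tvDist (M.transition (x, u)) (M.transition (x', u)) ≤ α * dist x x')
    (hc : ∀ (x x' : X) (u : U), |M.cost x u - M.cost x' u| ≤ K₁ * dist x x')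
    {N : ℕ} {J : Window Y U N → ℝ} (hJ : ∀ w, |J w| ≤ B) (w : Window Y U N) (u : U) (x x' : X) :
    |M.qfun β J w u x - M.qfun β J w u x'| ≤ (K₁ + α * β * B) * dist x x' := by
  have hB : 0 ≤ B := (abs_nonneg _).trans (hJ w)
  have hm : Measurable fun x => ∫ y, J (w.next u y) ∂M.channel x :=
    ((measurable_of_countable fun y => J (w.next u y)).stronglyMeasurable.integral_kernel
      (κ := M.channel)).measurable
  have h₁ := integral_sub_integral_le_tvDist (M.transition (x, u)) (M.transition (x', u)) hm
    (B := B) fun x => abs_integral_le_of_forall _ fun y => hJ _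
  have h₂ : M.qfun β J w u x - M.qfun β J w u x' = (M.cost x u - M.cost x' u) +
      β * (∫ x, ∫ y, J (w.next u y) ∂M.channel x ∂M.transition (x, u) -
        ∫ x, ∫ y, J (w.next u y) ∂M.channel x ∂M.transition (x', u)) := by
    simp only [qfun, integral_comp_eq]; ring
  rw [h₂]
  refine (abs_add_le _ _).trans ?_
  rw [abs_mul, abs_of_nonneg hβ]
  calc _ ≤ K₁ * dist x x' + β * (B * (α * dist x x')) := by
        gcongr
        · exact hc x x' u
        · exact h₁.trans (by gcongr; exact hT x x' u)
    _ = _ := by ring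

variable [Finite U] [MeasurableSingletonClass U] [Nonempty U]

/-- The one-step Bellman operator is the integral of `qfun`. -/
theorem approxQ_eq_integral  (M : POMDP X Y U) (β : ℝ) {N : ℕ} (ρ : Window Y U N → ProbabilityMeasure X)
    (zstar : ProbabilityMeasure X) (J : Window Y U N → ℝ) (w : Window Y U N) (u : U)
    (hc : Measurable fun x => M.cost x u) {C : ℝ} (hC : ∀ x, |M.cost x u| ≤ C) :
    M.approxQ β ρ zstar J w u =
      ∫ x, M.qfun β J w u x ∂(M.filter ρ zstar w : Measure X) := by
  have := Fintype.ofFinite Y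
  unfold approxQ qfun nextObsProb
  have hi : ∀ y, Integrable (fun x => ((M.channel ∘ₖ M.transition) (x, u)).real {y})
      (M.filter ρ zstar w : Measure X) := by
    intro y
    refine Integrable.of_bound ?_ 1 (Filter.Eventually.of_forall fun x => ?_)
    · have h := (M.channel ∘ₖ M.transition).measurable_coe (measurableSet_singleton y)
      exact (h.ennreal_toReal.comp
        (by fun_prop : Measurable fun x : X => (x, u))).aestronglyMeasurable
    · rw [Real.norm_of_nonneg measureReal_nonneg]; exact measureReal_le_one
  rw [integral_add (.of_bound hc.aestronglyMeasurable C (Filter.Eventually.of_forall hC)),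
    integral_const_mul]
  · congr 2
    simp only [integral_eq_finsum_real, finsum_eq_sum_of_fintype]
    rw [integral_finsetSum _ fun y _ => (hi y).const_mul _]
    simp only [integral_const_mul]
  · refine Integrable.const_mul ?_ β
    simp only [integral_eq_finsum_real, finsum_eq_sum_of_fintype]
    exact integrable_finsetSum _ fun y _ => (hi y).const_mul _

/-- A solution of the fixed point equation of the finite model is bounded by `‖c‖ / (1 - β)`. -/
theorem abs_le_of_isFixedPt (M : POMDP X Y U) {β C : ℝ} (hβ : 0 ≤ β) (hβ1 : β < 1)
    (hcm : ∀ u, Measurable fun x => M.cost x u)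
    (hC : ∀ (x : X) (u : U), |M.cost x u| ≤ C) {N : ℕ} {ρ : Window Y U N → ProbabilityMeasure X}
    {zstar : ProbabilityMeasure X} {φ : Window Y U N → U} {J : Window Y U N → ℝ}
    (hJ : ∀ w, J w = M.approxQ β ρ zstar J w (φ w)) (w : Window Y U N) :
    |J w| ≤ C / (1 - β) := by
  have : Nonempty (Window Y U N) := ⟨w⟩
  -- There are finitely many windows, so |J| has a maximum m, and the fixed point equation there
  -- gives m ≤ C + β m.
  obtain ⟨w₀, hw₀⟩ := Finite.exists_max fun w => |J w|
  have h : |J w₀| ≤ C + β * |J w₀| := by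
    have e := hJ w₀
    rw [approxQ_eq_integral M β ρ zstar J w₀ _ (hcm _) fun x => hC x _] at e
    have := norm_integral_le_of_norm_le_const (μ := (M.filter ρ zstar w₀ : Measure X))
      (f := M.qfun β J w₀ (φ w₀)) (C := C + β * |J w₀|)
      (Filter.Eventually.of_forall fun x => M.abs_qfun_le hβ hC hw₀ w₀ _ x)
    rw [← e] at this
    simpa using this
  refine (hw₀ w).trans ?_
  rw [le_div_iff₀ (by linarith)]
  linarith

end POMDP

/-! ### Functions of finitely many observations and actions -/

theorem ENNReal.ofReal_sum_le {ι : Type*} (s : Finset ι) (f : ι → ℝ) :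
    ENNReal.ofReal (∑ i ∈ s, f i) ≤ ∑ i ∈ s, ENNReal.ofReal (f i) :=
  Finset.le_sum_of_subadditive _ ENNReal.ofReal_zero.le (fun _ _ => ENNReal.ofReal_add_le) s f

section

variable {X Y U : Type*}

/-- The cylinder of the trajectories that share the first `n` observations and actions of `ω`. -/
abbrev cylOf (n : ℕ) (ω : ℕ → X × Y × U) : Set (ℕ → X × Y × U) := cyl n (obsOf ω) (actOf ω)

theorem cyl_anti {m n : ℕ} (h : m ≤ n) (y : ℕ → Y) (u : ℕ → U) :
    (cyl n y u : Set (ℕ → X × Y × U)) ⊆ cyl m y u :=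
  fun _ hω i hi => hω i (hi.trans_le h)

/-- The set `A` is determined by the first `n` observations and actions. -/
def IsPrefixSet (n : ℕ) (A : Set (ℕ → X × Y × U)) : Prop := ∀ ω ∈ A, cylOf n ω ⊆ A

theorem IsPrefixSet.mono {m n : ℕ} (h : m ≤ n) {A : Set (ℕ → X × Y × U)} (hA : IsPrefixSet m A) :
    IsPrefixSet n A :=
  fun ω hω => (cyl_anti h _ _).trans (hA ω hω)

theorem isPrefixSet_univ (n : ℕ) : IsPrefixSet n (Set.univ : Set (ℕ → X × Y × U)) :=
  fun _ _ => Set.subset_univ _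

theorem isPrefixSet_obsEvent {n : ℕ} (y : Fin n → Y) :
    IsPrefixSet n (obsEvent y : Set (ℕ → X × Y × U)) :=
  fun _ hω _ hω' i => ((hω' i i.2).1).trans (hω i)

/-- A function that depends on the first `n` observations and actions only. -/
def IsPrefixFun {β : Type*} (n : ℕ) (f : (ℕ → X × Y × U) → β) : Prop :=
  ∀ ω, ∀ ω' ∈ cylOf n ω, f ω' = f ω

theorem IsPrefixFun.preimage {β : Type*} {n : ℕ} {f : (ℕ → X × Y × U) → β} (hf : IsPrefixFun n f)
    (s : Set β) : IsPrefixSet n (f ⁻¹' s) := fun ω hω _ hω' => by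
  rw [Set.mem_preimage, hf ω _ hω']; exact hω

theorem isPrefixFun_windowAt {N t n : ℕ} (h : t + N + 1 ≤ n) :
    IsPrefixFun n (windowAt N t : (ℕ → X × Y × U) → Window Y U N) := fun _ _ hω' =>
  Prod.ext (funext fun i => (hω' (t + i) (by omega)).1) (funext fun i => (hω' (t + i) (by omega)).2)

/-- Only finitely many data prefixes of length n exist. Prefix sets are thus automatically
measurable, and estimates on them reduce to single cylinders, which play the role of conditional
expectations. -/
theorem exists_cyl_partition [Finite Y] [Finite U] {n : ℕ} {A : Set (ℕ → X × Y × U)}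
    (hA : IsPrefixSet n A) :
    ∃ S : Set (Fin n → Y × U), ∃ c : S → ℕ → X × Y × U, (∀ i, c i ∈ A) ∧
      Pairwise (Function.onFun Disjoint fun i => cylOf n (c i)) ∧ A = ⋃ i, cylOf n (c i) := by
  let p : (ℕ → X × Y × U) → Fin n → Y × U := fun ω i => (ω i).2
  have hp : ∀ ω ω' : ℕ → X × Y × U, ω' ∈ cylOf n ω ↔ p ω' = p ω := fun ω ω' =>
    ⟨fun h => funext fun i => Prod.ext (h i i.2).1 (h i i.2).2,
      fun h i hi => ⟨congrArg Prod.fst (congrFun h ⟨i, hi⟩), congrArg Prod.snd (congrFun h ⟨i, hi⟩)⟩⟩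
  have hc : ∀ i : p '' A, ∃ ω ∈ A, p ω = i := fun i => i.2
  choose c hcA hcp using hc
  refine ⟨p '' A, c, hcA, fun i j hij => ?_, ?_⟩
  · refine Set.disjoint_left.2 fun ω hi hj => hij (Subtype.ext ?_)
    rw [← hcp i, ← hcp j, ← (hp _ _).1 hi, ← (hp _ _).1 hj]
  · ext ω
    simp only [Set.mem_iUnion]
    refine ⟨fun h => ⟨⟨p ω, ω, h, rfl⟩, (hp _ _).2 (hcp ⟨p ω, ω, h, rfl⟩).symm⟩, ?_⟩
    rintro ⟨i, hi⟩
    exact hA _ (hcA i) hi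

theorem windowAt_zero (N : ℕ) (ω : ℕ → X × Y × U) :
    windowAt N 0 ω = (fun i : Fin (N + 1) => obsOf ω i, fun i : Fin N => actOf ω i) := by
  simp [windowAt, obsOf, actOf]

theorem snoc_segment {α : Type*} (a : ℕ → α) (t n : ℕ) (j : Fin (n + 1)) :
    Fin.snoc (α := fun _ => α) (fun i : Fin n => a (t + i)) (a (t + n)) j = a (t + j) := by
  refine Fin.lastCases ?_ (fun j => ?_) j <;> simp

theorem windowAt_succ (N t : ℕ) (ω : ℕ → X × Y × U) :
    windowAt N (t + 1) ω = (windowAt N t ω).next (actOf ω (t + N)) (obsOf ω (t + (N + 1))) := by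
  refine Prod.ext (funext fun i => ?_) (funext fun i => ?_)
  · have h := snoc_segment (obsOf ω) t (N + 1) i.succ
    refine Eq.trans ?_ h.symm
    change obsOf ω (t + 1 + i) = obsOf ω (t + (i + 1))
    rw [Nat.add_right_comm, Nat.add_assoc]
  · have h := snoc_segment (actOf ω) t N i.succ
    refine Eq.trans ?_ h.symm
    change actOf ω (t + 1 + i) = actOf ω (t + (i + 1))
    rw [Nat.add_right_comm, Nat.add_assoc]

variable [MeasurableSpace X] [MeasurableSpace Y] [MeasurableSpace U]
  [Finite Y] [MeasurableSingletonClass Y] [Finite U] [MeasurableSingletonClass U]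

theorem IsPrefixSet.measurableSet {n : ℕ} {A : Set (ℕ → X × Y × U)} (hA : IsPrefixSet n A) :
    MeasurableSet A := by
  obtain ⟨S, c, -, -, rfl⟩ := exists_cyl_partition hA
  exact MeasurableSet.iUnion fun i => measurableSet_cyl _ _ _

theorem IsPrefixFun.measurable {β : Type*} [MeasurableSpace β] {n : ℕ}
    {f : (ℕ → X × Y × U) → β} (hf : IsPrefixFun n f) : Measurable f :=
  fun s _ => (hf.preimage s).measurableSet

theorem setLIntegral_le_of_cyl {μ : Measure (ℕ → X × Y × U)} {n : ℕ} {A : Set (ℕ → X × Y × U)}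
    (hA : IsPrefixSet n A) {f g : (ℕ → X × Y × U) → ℝ≥0∞}
    (h : ∀ ω ∈ A, ∫⁻ ω' in cylOf n ω, f ω' ∂μ ≤ ∫⁻ ω' in cylOf n ω, g ω' ∂μ) :
    ∫⁻ ω in A, f ω ∂μ ≤ ∫⁻ ω in A, g ω ∂μ := by
  obtain ⟨S, c, hc, hd, rfl⟩ := exists_cyl_partition hA
  rw [lintegral_iUnion (fun i => measurableSet_cyl _ _ _) hd,
    lintegral_iUnion (fun i => measurableSet_cyl _ _ _) hd]
  exact ENNReal.tsum_le_tsum fun i => h _ (hc i)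

theorem ofReal_setIntegral_le_of_cyl {μ : Measure (ℕ → X × Y × U)} {n : ℕ}
    {A : Set (ℕ → X × Y × U)} (hA : IsPrefixSet n A) {f : (ℕ → X × Y × U) → ℝ}
    (hf : Integrable f μ) {g : (ℕ → X × Y × U) → ℝ≥0∞}
    (h : ∀ ω ∈ A, ENNReal.ofReal (∫ ω' in cylOf n ω, f ω' ∂μ) ≤ ∫⁻ ω' in cylOf n ω, g ω' ∂μ) :
    ENNReal.ofReal (∫ ω in A, f ω ∂μ) ≤ ∫⁻ ω in A, g ω ∂μ := by
  obtain ⟨S, c, hc, hd, rfl⟩ := exists_cyl_partition hA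
  have := Fintype.ofFinite S
  rw [lintegral_iUnion (fun i => measurableSet_cyl _ _ _) hd,
    integral_iUnion (fun i => measurableSet_cyl _ _ _) hd hf.integrableOn, tsum_fintype,
    tsum_fintype]
  exact (ENNReal.ofReal_sum_le _ _).trans (Finset.sum_le_sum fun i _ => h _ (hc i))

end

namespace POMDP

variable {X Y U : Type*} [MeasurableSpace X] [MeasurableSpace Y] [MeasurableSpace U]

/-! ### One step of the controlled process -/

/-- The defect of the Bellman equation of the finite model along a trajectory. -/
def residual (M : POMDP X Y U) (β : ℝ) {N : ℕ} (J : Window Y U N → ℝ) (t : ℕ)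
    (ω : ℕ → X × Y × U) : ℝ :=
  J (windowAt N t ω) -
    (M.cost (ω (t + N)).1 (ω (t + N)).2.2 + β * J (windowAt N (t + 1) ω))

theorem measurable_cost_comp [Finite U] [MeasurableSingletonClass U] (M : POMDP X Y U) (hcm : ∀ u, Measurable fun x => M.cost x u) (n : ℕ) :
    Measurable fun ω : ℕ → X × Y × U => M.cost (ω n).1 (ω n).2.2 := by
  have h : Measurable fun p : X × U => M.cost p.1 p.2 := measurable_from_prod_countable_left hcm
  exact h.comp ((measurable_pi_apply n).fst.prodMk (measurable_pi_apply n).snd.snd)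

theorem abs_residual_le (M : POMDP X Y U) {β C B : ℝ} (hβ : 0 ≤ β)
    (hC : ∀ x u, |M.cost x u| ≤ C) {N : ℕ} {J : Window Y U N → ℝ} (hJ : ∀ w, |J w| ≤ B) (t : ℕ)
    (ω : ℕ → X × Y × U) : |M.residual β J t ω| ≤ B + (C + β * B) := by
  refine (abs_sub _ _).trans (add_le_add (hJ _) ((abs_add_le _ _).trans (add_le_add (hC _ _) ?_)))
  rw [abs_mul, abs_of_nonneg hβ]
  exact mul_le_mul_of_nonneg_left (hJ _) hβ

variable [Finite Y] [MeasurableSingletonClass Y] [Finite U] [MeasurableSingletonClass U]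

theorem measurable_windowAt (N t : ℕ) :
    Measurable (windowAt N t : (ℕ → X × Y × U) → Window Y U N) :=
  (isPrefixFun_windowAt le_rfl).measurable

theorem measurable_residual (M : POMDP X Y U) (hcm : ∀ u, Measurable fun x => M.cost x u) (β : ℝ)
    {N : ℕ} (J : Window Y U N → ℝ) (t : ℕ) : Measurable (M.residual β J t) := by
  have hJ : Measurable J := measurable_of_countable _
  exact (hJ.comp (measurable_windowAt N t)).sub
    ((M.measurable_cost_comp hcm _).add ((hJ.comp (measurable_windowAt N (t + 1))).const_mul β))

theorem lintegral_comp_cylOf_succ (M : POMDP X Y U) (z : ProbabilityMeasure X) (γ : Policy Y U)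
    (n : ℕ) (ω₀ : ℕ → X × Y × U) (hγ : γ.Consistent (n + 1) (obsOf ω₀) (actOf ω₀))
    (F : Y → ℝ≥0∞) :
    ∫⁻ ω in cylOf (n + 1) ω₀, F (obsOf ω (n + 1)) ∂M.pathLaw z γ =
      ∫⁻ x, ∫⁻ y, F y ∂(M.channel ∘ₖ M.transition) (x, actOf ω₀ n)
        ∂M.ufilt z (obsOf ω₀) (actOf ω₀) n := by
  have hF : Measurable F := measurable_of_countable _
  have h := M.map_obs_restrict_cyl_succ z γ n (obsOf ω₀) (actOf ω₀)
  rw [if_pos hγ] at h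
  have hm : Measurable fun x => (M.channel ∘ₖ M.transition) (x, actOf ω₀ n) :=
    (M.channel ∘ₖ M.transition).measurable.comp (by fun_prop)
  rw [← Measure.lintegral_bind hm.aemeasurable hF.aemeasurable, ← h,
    lintegral_map hF (by fun_prop)]
  rfl

/-- On the cylinder the window and the action are constant and the state has the unnormalised filter
as its law. Only the next observation remains to be averaged, which turns the defect into `qfun`. -/
theorem integral_residual (M : POMDP X Y U) (hcm : ∀ u, Measurable fun x => M.cost x u)
    {β C : ℝ} (hC : ∀ x u, |M.cost x u| ≤ C) {N : ℕ} (J : Window Y U N → ℝ)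
    (z : ProbabilityMeasure X) (γ : Policy Y U) (t : ℕ) (ω₀ : ℕ → X × Y × U)
    (hγ : γ.Consistent (t + N + 1) (obsOf ω₀) (actOf ω₀)) :
    ∫ ω in cylOf (t + N + 1) ω₀, M.residual β J t ω ∂M.pathLaw z γ =
      ∫ x, (J (windowAt N t ω₀) - M.qfun β J (windowAt N t ω₀) (actOf ω₀ (t + N)) x)
        ∂M.ufilt z (obsOf ω₀) (actOf ω₀) (t + N) := by
  set w := windowAt N t ω₀
  set u := actOf ω₀ (t + N)
  set σ := M.ufilt z (obsOf ω₀) (actOf ω₀) (t + N)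
  have := Fintype.ofFinite Y
  have h₁ := M.map_state_restrict_cyl_succ z γ (t + N) (obsOf ω₀) (actOf ω₀)
  have h₂ := M.map_obs_restrict_cyl_succ z γ (t + N) (obsOf ω₀) (actOf ω₀)
  rw [if_pos hγ] at h₁ h₂
  let κ : Kernel X Y := (M.channel ∘ₖ M.transition).comap (fun x => (x, u)) (by fun_prop)
  have h₂' : ((M.pathLaw z γ).restrict (cylOf (t + N + 1) ω₀)).map
      (fun ω => (ω (t + N + 1)).2.1) = κ ∘ₘ σ := h₂
  have hF : Measurable fun y => β * J (w.next u y) := measurable_of_countable _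
  have hfm : Measurable fun x => J w - M.cost x u := (hcm u).const_sub _
  have e : ∀ ω ∈ cylOf (t + N + 1) ω₀, M.residual β J t ω =
      (J w - M.cost (ω (t + N)).1 u) - β * J (w.next u (ω (t + N + 1)).2.1) := by
    intro ω hω
    have hu : (ω (t + N)).2.2 = u := (hω (t + N) (by omega)).2
    rw [residual, windowAt_succ, isPrefixFun_windowAt le_rfl ω₀ ω hω]
    simp only [actOf, obsOf, hu, ← Nat.add_assoc]
    ring
  have hfi : ∀ (μ : Measure X) [IsFiniteMeasure μ], Integrable (fun x => J w - M.cost x u) μ :=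
    fun μ _ => .of_bound hfm.aestronglyMeasurable (|J w| + C)
      (Filter.Eventually.of_forall fun x => (abs_sub _ _).trans (by gcongr; exact hC x u))
  have hi₁ : Integrable (fun ω : ℕ → X × Y × U => J w - M.cost (ω (t + N)).1 u)
      ((M.pathLaw z γ).restrict (cylOf (t + N + 1) ω₀)) :=
    .of_bound (hfm.comp (by fun_prop)).aestronglyMeasurable (|J w| + C)
      (Filter.Eventually.of_forall fun ω => (abs_sub _ _).trans (by gcongr; exact hC _ u))
  have hi₂ : Integrable (fun ω : ℕ → X × Y × U => β * J (w.next u (ω (t + N + 1)).2.1))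
      ((M.pathLaw z γ).restrict (cylOf (t + N + 1) ω₀)) := by
    have h : Integrable (fun y => β * J (w.next u y))
        (((M.pathLaw z γ).restrict (cylOf (t + N + 1) ω₀)).map
          (fun ω => (ω (t + N + 1)).2.1)) := .of_finite
    exact h.comp_measurable (by fun_prop)
  rw [setIntegral_congr_fun (measurableSet_cyl _ _ _) e, integral_sub hi₁ hi₂]
  have e₁ : ∫ ω in cylOf (t + N + 1) ω₀, (J w - M.cost (ω (t + N)).1 u) ∂M.pathLaw z γ =
      ∫ x, (J w - M.cost x u) ∂σ := by
    change _ = ∫ x, (J w - M.cost x u) ∂M.ufilt z (obsOf ω₀) (actOf ω₀) (t + N)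
    rw [← h₁, integral_map (Measurable.aemeasurable (by fun_prop)) hfm.aestronglyMeasurable]
  have hFi : Integrable (fun p : X × Y => β * J (w.next u p.2)) (σ ⊗ₘ κ) := by
    have h : Integrable (fun y => β * J (w.next u y)) ((σ ⊗ₘ κ).map Prod.snd) := .of_finite
    exact h.comp_measurable measurable_snd
  -- The next observation has law `κ ∘ₘ σ`, the second marginal of `σ ⊗ₘ κ`; Fubini then integrates
  -- over it first.
  have e₂ : ∫ ω in cylOf (t + N + 1) ω₀, β * J (w.next u (ω (t + N + 1)).2.1) ∂M.pathLaw z γ =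
      ∫ x, ∫ y, β * J (w.next u y) ∂κ x ∂σ := by
    rw [← Measure.integral_compProd hFi, ← integral_map (φ := fun ω : ℕ → X × Y × U => (ω (t + N + 1)).2.1)
        (Measurable.aemeasurable (by fun_prop)) hF.aestronglyMeasurable,
      ← integral_map (φ := Prod.snd) (by fun_prop) hF.aestronglyMeasurable, h₂',
      ← Measure.snd_compProd, Measure.snd]
  rw [e₁, e₂, ← integral_sub (hfi σ)]
  · refine integral_congr_ae (Filter.Eventually.of_forall fun x => ?_)
    change J w - M.cost x u - ∫ y, β * J (w.next u y) ∂(M.channel ∘ₖ M.transition) (x, u) = _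
    rw [integral_const_mul]
    simp only [qfun]
    ring
  · exact .of_bound (hF.stronglyMeasurable.integral_kernel (κ := κ)).aestronglyMeasurable
      (∑ y, |β * J (w.next u y)|) (Filter.Eventually.of_forall fun x =>
        abs_integral_le_of_forall (κ x) fun y =>
          Finset.single_le_sum (f := fun y => |β * J (w.next u y)|) (fun _ _ => abs_nonneg _)
            (Finset.mem_univ y))

theorem measure_cylOf_succ (M : POMDP X Y U) (z : ProbabilityMeasure X) (γ : Policy Y U)
    (n : ℕ) (ω : ℕ → X × Y × U) (hγ : γ.Consistent (n + 1) (obsOf ω) (actOf ω)) :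
    M.pathLaw z γ (cylOf (n + 1) ω) = M.ufilt z (obsOf ω) (actOf ω) n Set.univ := by
  classical
  rw [pathLaw_cyl, if_pos hγ, upred_succ_univ]

theorem consistent_of_measure_ne_zero (M : POMDP X Y U) (z : ProbabilityMeasure X) (γ : Policy Y U)
    (n : ℕ) (ω : ℕ → X × Y × U) (h : M.pathLaw z γ (cylOf n ω) ≠ 0) :
    γ.Consistent n (obsOf ω) (actOf ω) := by
  classical
  by_contra hγ
  rw [pathLaw_cyl, if_neg hγ] at h
  exact h rfl

theorem setLIntegral_cylOf_prefix (M : POMDP X Y U) (z : ProbabilityMeasure X) (γ : Policy Y U)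
    {n : ℕ} {f : (ℕ → X × Y × U) → ℝ≥0∞} (hf : IsPrefixFun n f) (ω₀ : ℕ → X × Y × U) :
    ∫⁻ ω in cylOf n ω₀, f ω ∂M.pathLaw z γ = f ω₀ * M.pathLaw z γ (cylOf n ω₀) := by
  rw [setLIntegral_congr_fun (measurableSet_cyl _ _ _) (hf ω₀), setLIntegral_const]

/-! ### Predictors and window filters along a trajectory -/

variable [Nonempty U]

/-- The predictor `z_t^-` along a trajectory. -/
def predAt (M : POMDP X Y U) (z : ProbabilityMeasure X) (t : ℕ) (ω : ℕ → X × Y × U) :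
    ProbabilityMeasure X :=
  M.predictor z t (fun i => (ω i).2.1) (fun i => (ω i).2.2)

theorem isPrefixFun_predAt (M : POMDP X Y U) (z : ProbabilityMeasure X) {t n : ℕ} (h : t ≤ n) :
    IsPrefixFun n (M.predAt z t) := fun ω ω' hω' => by
  unfold predAt
  congr 1
  · exact funext fun i => (hω' i (by omega)).1
  · exact funext fun i => (hω' i (by omega)).2

theorem filter_predAt (M : POMDP X Y U) (z : ProbabilityMeasure X) {N : ℕ}
    (ρ : Window Y U N → ProbabilityMeasure X) (t : ℕ) (ω : ℕ → X × Y × U)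
    (h : M.ufilt z (obsOf ω) (actOf ω) (t + N) Set.univ ≠ 0) :
    (M.filter ρ (M.predAt z t ω) (windowAt N t ω) : Measure X) =
      normed (M.ufilt z (obsOf ω) (actOf ω) (t + N)) :=
  M.filter_predictor z ρ t (obsOf ω) (actOf ω) h

theorem ufilt_eq_smul_filter (M : POMDP X Y U) (z : ProbabilityMeasure X) {N : ℕ}
    (ρ : Window Y U N → ProbabilityMeasure X) (t : ℕ) (ω : ℕ → X × Y × U)
    (h : M.ufilt z (obsOf ω) (actOf ω) (t + N) Set.univ ≠ 0) :
    M.ufilt z (obsOf ω) (actOf ω) (t + N) =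
      M.ufilt z (obsOf ω) (actOf ω) (t + N) Set.univ •
        (M.filter ρ (M.predAt z t ω) (windowAt N t ω) : Measure X) := by
  rw [M.filter_predAt z ρ t ω h, smul_normed]

/-- The predictor that follows `p` when the window `w` is observed and then `u` is played. -/
def nextPred (M : POMDP X Y U) {N : ℕ} (p : ProbabilityMeasure X) (w : Window Y U N) (u : U) :
    ProbabilityMeasure X :=
  M.predictor p 1 (fun _ => w.1 0) (fun _ => (Fin.snoc (α := fun _ => U) w.2 u : Fin (N + 1) → U) 0)

/-- The pair that leaves the window drives the predictor. Appending the current action before taking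
the first entry covers N = 0, where the window contains no action. -/
theorem predAt_succ (M : POMDP X Y U) (z : ProbabilityMeasure X) (N t : ℕ) (ω : ℕ → X × Y × U)
    (h : M.upred z (obsOf ω) (actOf ω) (t + 1) Set.univ ≠ 0) :
    M.predAt z (t + 1) ω =
      M.nextPred (M.predAt z t ω) (windowAt N t ω) (actOf ω (t + N)) := by
  have h₁ := M.predictor_succ z t (obsOf ω) (actOf ω) h
  have h₂ := snoc_segment (actOf ω) t N 0
  refine h₁.trans ?_
  unfold nextPred
  congr 1
  exact funext fun _ => h₂.symm

/-- Makes every function of predictor and window measurable along trajectories, without any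
measurability in the predictor. -/
theorem isPrefixFun_gap {β : Type*} (M : POMDP X Y U) (z : ProbabilityMeasure X) {N t n : ℕ}
    (h : t + N + 1 ≤ n) (F : ProbabilityMeasure X → Window Y U N → β) :
    IsPrefixFun n fun ω => F (M.predAt z t ω) (windowAt N t ω) := fun ω ω' hω' => by
  simp only [M.isPrefixFun_predAt z (by omega : t ≤ n) ω ω' hω',
    isPrefixFun_windowAt h ω ω' hω']

/-- The distance of the window filters started from the predictor and from `zstar`. -/
def filterGap [MetricSpace X] (M : POMDP X Y U) {N : ℕ} (ρ : Window Y U N → ProbabilityMeasure X)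
    (zstar p : ProbabilityMeasure X) (w : Window Y U N) : ℝ≥0∞ :=
  wasserstein (M.filter ρ p w : Measure X) (M.filter ρ zstar w : Measure X)

end POMDP

namespace POMDP

/-! ### The worst-case discounted filter gap -/

section

variable {X Y U : Type*} [MetricSpace X] [MeasurableSpace X] [MeasurableSpace Y]
  [MeasurableSpace U] [Finite Y] [MeasurableSingletonClass Y] [Finite U]
  [MeasurableSingletonClass U] [Nonempty U]

/-- The largest expected discounted sum of the next `k` filter gaps over all policies, as a
function of the predictor and the window. -/
def worstGap (M : POMDP X Y U) (β : ℝ) {N : ℕ} (ρ : Window Y U N → ProbabilityMeasure X)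
    (zstar : ProbabilityMeasure X) : ℕ → ProbabilityMeasure X → Window Y U N → ℝ≥0∞
  | 0, _, _ => 0
  | k + 1, p, w => M.filterGap ρ zstar p w + ENNReal.ofReal β * ⨆ u : U,
      ∫⁻ x, ∫⁻ y, worstGap M β ρ zstar k (M.nextPred p w u) (w.next u y)
        ∂(M.channel ∘ₖ M.transition) (x, u) ∂(M.filter ρ p w : Measure X)

/-- The expectation of `worstGap k` at the next predictor and window. -/
def nextGap (M : POMDP X Y U) (β : ℝ) {N : ℕ} (ρ : Window Y U N → ProbabilityMeasure X)
    (zstar : ProbabilityMeasure X) (k : ℕ) (p : ProbabilityMeasure X) (w : Window Y U N) (u : U) :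
    ℝ≥0∞ :=
  ∫⁻ x, ∫⁻ y, M.worstGap β ρ zstar k (M.nextPred p w u) (w.next u y)
    ∂(M.channel ∘ₖ M.transition) (x, u) ∂(M.filter ρ p w : Measure X)

theorem worstGap_succ (M : POMDP X Y U) (β : ℝ) {N : ℕ} (ρ : Window Y U N → ProbabilityMeasure X)
    (zstar : ProbabilityMeasure X) (k : ℕ) (p : ProbabilityMeasure X) (w : Window Y U N) :
    M.worstGap β ρ zstar (k + 1) p w =
      M.filterGap ρ zstar p w + ENNReal.ofReal β * ⨆ u, M.nextGap β ρ zstar k p w u := rfl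

theorem worstGap_mono (M : POMDP X Y U) (β : ℝ) {N : ℕ} (ρ : Window Y U N → ProbabilityMeasure X)
    (zstar : ProbabilityMeasure X) (p : ProbabilityMeasure X) (w : Window Y U N) :
    Monotone fun k => M.worstGap β ρ zstar k p w := by
  refine monotone_nat_of_le_succ fun k => ?_
  induction k generalizing p w with
  | zero => exact zero_le
  | succ k ih =>
    rw [worstGap_succ, worstGap_succ]
    unfold nextGap
    gcongr
    exact ih _ _

/-- An action that maximises the expected future filter gap. -/
def worstAction (M : POMDP X Y U) (β : ℝ) {N : ℕ} (ρ : Window Y U N → ProbabilityMeasure X)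
    (zstar : ProbabilityMeasure X) (k : ℕ) (p : ProbabilityMeasure X) (w : Window Y U N) : U :=
  (exists_eq_ciSup_of_finite (f := M.nextGap β ρ zstar k p w)).choose

theorem nextGap_worstAction (M : POMDP X Y U) (β : ℝ) {N : ℕ}
    (ρ : Window Y U N → ProbabilityMeasure X) (zstar : ProbabilityMeasure X) (k : ℕ)
    (p : ProbabilityMeasure X) (w : Window Y U N) :
    M.nextGap β ρ zstar k p w (M.worstAction β ρ zstar k p w) =
      ⨆ u, M.nextGap β ρ zstar k p w u :=
  (exists_eq_ciSup_of_finite (f := M.nextGap β ρ zstar k p w)).choose_spec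

/-- On a cylinder of positive probability the window filter started from the predictor is the true
conditional law of the state, so `nextGap` is a genuine conditional expectation. On null cylinders
the filter may be an arbitrary version. -/
theorem setLIntegral_worstGap_next (M : POMDP X Y U) (β : ℝ) {N : ℕ}
    (ρ : Window Y U N → ProbabilityMeasure X) (zstar z : ProbabilityMeasure X) (γ : Policy Y U)
    (k t : ℕ) (ω₀ : ℕ → X × Y × U) (h0 : M.pathLaw z γ (cylOf (t + N + 1) ω₀) ≠ 0) :
    ∫⁻ ω in cylOf (t + N + 1) ω₀,
        M.worstGap β ρ zstar k (M.predAt z (t + 1) ω) (windowAt N (t + 1) ω) ∂M.pathLaw z γ =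
      M.nextGap β ρ zstar k (M.predAt z t ω₀) (windowAt N t ω₀) (actOf ω₀ (t + N)) *
        M.pathLaw z γ (cylOf (t + N + 1) ω₀) := by
  have hγ := M.consistent_of_measure_ne_zero z γ _ ω₀ h0
  have hm := M.measure_cylOf_succ z γ (t + N) ω₀ hγ
  have hσ : M.ufilt z (obsOf ω₀) (actOf ω₀) (t + N) Set.univ ≠ 0 := hm ▸ h0
  have hp : M.upred z (obsOf ω₀) (actOf ω₀) (t + 1) Set.univ ≠ 0 := by
    refine M.upred_univ_ne_zero _ _ _ (t + 1) N ?_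
    rwa [Nat.add_right_comm, upred_succ_univ]
  have e : ∀ ω ∈ cylOf (t + N + 1) ω₀,
      M.worstGap β ρ zstar k (M.predAt z (t + 1) ω) (windowAt N (t + 1) ω) =
      M.worstGap β ρ zstar k
        (M.nextPred (M.predAt z t ω₀) (windowAt N t ω₀) (actOf ω₀ (t + N)))
        ((windowAt N t ω₀).next (actOf ω₀ (t + N)) (obsOf ω (t + N + 1))) := by
    intro ω hω
    rw [windowAt_succ, M.isPrefixFun_predAt z (by omega : t + 1 ≤ t + N + 1) ω₀ ω hω,
      M.predAt_succ z N t ω₀ hp, isPrefixFun_windowAt le_rfl ω₀ ω hω,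
      show actOf ω (t + N) = actOf ω₀ (t + N) from (hω (t + N) (by omega)).2]
    rfl
  rw [setLIntegral_congr_fun (measurableSet_cyl _ _ _) e,
    M.lintegral_comp_cylOf_succ z γ (t + N) ω₀ hγ fun y => M.worstGap β ρ zstar k
      (M.nextPred (M.predAt z t ω₀) (windowAt N t ω₀) (actOf ω₀ (t + N)))
      ((windowAt N t ω₀).next (actOf ω₀ (t + N)) y), hm]
  conv_lhs => rw [M.ufilt_eq_smul_filter z ρ t ω₀ hσ]
  rw [lintegral_smul_measure, smul_eq_mul, mul_comm]
  rfl

/-- Dynamic programming inequality: on each cylinder the action played does no better than the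
maximum over actions. The policy may depend on the whole history. -/
theorem setLIntegral_gap_add_le (M : POMDP X Y U) (β : ℝ) {N : ℕ}
    (ρ : Window Y U N → ProbabilityMeasure X) (zstar z : ProbabilityMeasure X) (γ : Policy Y U)
    (k t : ℕ) {A : Set (ℕ → X × Y × U)} (hA : IsPrefixSet (t + N + 1) A) :
    ∫⁻ ω in A, M.filterGap ρ zstar (M.predAt z t ω) (windowAt N t ω) ∂M.pathLaw z γ +
        ENNReal.ofReal β * ∫⁻ ω in A,
          M.worstGap β ρ zstar k (M.predAt z (t + 1) ω) (windowAt N (t + 1) ω) ∂M.pathLaw z γ ≤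
      ∫⁻ ω in A, M.worstGap β ρ zstar (k + 1) (M.predAt z t ω) (windowAt N t ω)
        ∂M.pathLaw z γ := by
  have hm₁ := (M.isPrefixFun_gap z le_rfl (M.filterGap ρ zstar) (N := N) (t := t)).measurable
  rw [← lintegral_const_mul' _ _ ENNReal.ofReal_ne_top, ← lintegral_add_left hm₁]
  refine setLIntegral_le_of_cyl hA fun ω₀ _ => ?_
  rw [lintegral_add_left hm₁, lintegral_const_mul' _ _ ENNReal.ofReal_ne_top,
    M.setLIntegral_cylOf_prefix z γ (M.isPrefixFun_gap z le_rfl (M.filterGap ρ zstar)),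
    M.setLIntegral_cylOf_prefix z γ (M.isPrefixFun_gap z le_rfl (M.worstGap β ρ zstar (k + 1)))]
  by_cases h0 : M.pathLaw z γ (cylOf (t + N + 1) ω₀) = 0
  · rw [setLIntegral_measure_zero _ _ h0]; simp [h0]
  · rw [M.setLIntegral_worstGap_next β ρ zstar z γ k t ω₀ h0, ← mul_assoc, ← add_mul, worstGap_succ]
    gcongr
    exact le_iSup (M.nextGap β ρ zstar k _ _) _

/-- Converse inequality when the action played attains the maximum. -/
theorem setLIntegral_worstGap_succ_le (M : POMDP X Y U) (β : ℝ) {N : ℕ}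
    (ρ : Window Y U N → ProbabilityMeasure X) (zstar z : ProbabilityMeasure X) (γ : Policy Y U)
    (k t : ℕ) {A : Set (ℕ → X × Y × U)} (hA : IsPrefixSet (t + N + 1) A)
    (hγ : ∀ ω : ℕ → X × Y × U, γ (t + N) (fun i => (ω i).2.1) (fun i => (ω i).2.2) =
      M.worstAction β ρ zstar k (M.predAt z t ω) (windowAt N t ω)) :
    ∫⁻ ω in A, M.worstGap β ρ zstar (k + 1) (M.predAt z t ω) (windowAt N t ω)
        ∂M.pathLaw z γ ≤
    ∫⁻ ω in A, M.filterGap ρ zstar (M.predAt z t ω) (windowAt N t ω) ∂M.pathLaw z γ +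
        ENNReal.ofReal β * ∫⁻ ω in A,
          M.worstGap β ρ zstar k (M.predAt z (t + 1) ω) (windowAt N (t + 1) ω)
            ∂M.pathLaw z γ := by
  have hm₁ := (M.isPrefixFun_gap z le_rfl (M.filterGap ρ zstar) (N := N) (t := t)).measurable
  rw [← lintegral_const_mul' _ _ ENNReal.ofReal_ne_top, ← lintegral_add_left hm₁]
  refine setLIntegral_le_of_cyl hA fun ω₀ _ => ?_
  rw [lintegral_add_left hm₁, lintegral_const_mul' _ _ ENNReal.ofReal_ne_top,
    M.setLIntegral_cylOf_prefix z γ (M.isPrefixFun_gap z le_rfl (M.filterGap ρ zstar)),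
    M.setLIntegral_cylOf_prefix z γ (M.isPrefixFun_gap z le_rfl (M.worstGap β ρ zstar (k + 1)))]
  by_cases h0 : M.pathLaw z γ (cylOf (t + N + 1) ω₀) = 0
  · simp [h0]
  · have hu : actOf ω₀ (t + N) =
        M.worstAction β ρ zstar k (M.predAt z t ω₀) (windowAt N t ω₀) := by
      rw [← hγ ω₀]
      exact (M.consistent_of_measure_ne_zero z γ _ ω₀ h0 (t + N) (by omega)).symm
    rw [M.setLIntegral_worstGap_next β ρ zstar z γ k t ω₀ h0, ← mul_assoc, ← add_mul,
      worstGap_succ, hu, nextGap_worstAction]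

/-- The expected discounted sum of `k` filter gaps from time `t` on, on the event `A`. -/
def gapSum (M : POMDP X Y U) (β : ℝ) {N : ℕ} (ρ : Window Y U N → ProbabilityMeasure X)
    (zstar z : ProbabilityMeasure X) (γ : Policy Y U) (A : Set (ℕ → X × Y × U)) (t k : ℕ) : ℝ≥0∞ :=
  ∑ s ∈ Finset.range k, ENNReal.ofReal (β ^ s) * ∫⁻ ω in A,
    M.filterGap ρ zstar (M.predAt z (t + s) ω) (windowAt N (t + s) ω) ∂M.pathLaw z γ

theorem gapSum_succ (M : POMDP X Y U) {β : ℝ} (hβ : 0 ≤ β) {N : ℕ}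
    (ρ : Window Y U N → ProbabilityMeasure X) (zstar z : ProbabilityMeasure X) (γ : Policy Y U)
    (A : Set (ℕ → X × Y × U)) (t k : ℕ) :
    M.gapSum β ρ zstar z γ A t (k + 1) =
      ∫⁻ ω in A, M.filterGap ρ zstar (M.predAt z t ω) (windowAt N t ω) ∂M.pathLaw z γ +
        ENNReal.ofReal β * M.gapSum β ρ zstar z γ A (t + 1) k := by
  rw [gapSum, Finset.sum_range_succ', add_comm, gapSum, Finset.mul_sum]
  congr 1
  · simp
  · refine Finset.sum_congr rfl fun s _ => ?_
    rw [← mul_assoc, ← ENNReal.ofReal_mul hβ, pow_succ', show t + 1 + s = t + (s + 1) by omega]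

theorem gapSum_le_worstGap (M : POMDP X Y U) {β : ℝ} (hβ : 0 ≤ β) {N : ℕ}
    (ρ : Window Y U N → ProbabilityMeasure X) (zstar z : ProbabilityMeasure X) (γ : Policy Y U)
    (k t : ℕ) {A : Set (ℕ → X × Y × U)} (hA : IsPrefixSet (t + N + 1) A) :
    M.gapSum β ρ zstar z γ A t k ≤
      ∫⁻ ω in A, M.worstGap β ρ zstar k (M.predAt z t ω) (windowAt N t ω) ∂M.pathLaw z γ := by
  induction k generalizing t with
  | zero => simp [gapSum]
  | succ k ih =>
    rw [M.gapSum_succ hβ]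
    refine le_trans ?_ (M.setLIntegral_gap_add_le β ρ zstar z γ k t hA)
    gcongr
    exact ih (t + 1) (hA.mono (by omega))

/-- The maximising feedback is not stationary: after the gap at step s, k - 1 - s gaps remain. -/
theorem worstGap_le_gapSum (M : POMDP X Y U) {β : ℝ} (hβ : 0 ≤ β) {N : ℕ}
    (ρ : Window Y U N → ProbabilityMeasure X) (zstar z : ProbabilityMeasure X) (γ : Policy Y U)
    (k t : ℕ) {A : Set (ℕ → X × Y × U)} (hA : IsPrefixSet (t + N + 1) A)
    (hγ : ∀ s < k, ∀ ω : ℕ → X × Y × U,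
      γ (t + s + N) (fun i => (ω i).2.1) (fun i => (ω i).2.2) =
        M.worstAction β ρ zstar (k - 1 - s) (M.predAt z (t + s) ω) (windowAt N (t + s) ω)) :
    ∫⁻ ω in A, M.worstGap β ρ zstar k (M.predAt z t ω) (windowAt N t ω) ∂M.pathLaw z γ ≤
      M.gapSum β ρ zstar z γ A t k := by
  induction k generalizing t with
  | zero => simp [gapSum, worstGap]
  | succ k ih =>
    rw [M.gapSum_succ hβ]
    refine (M.setLIntegral_worstGap_succ_le β ρ zstar z γ k t hA (hγ 0 (by omega))).trans ?_
    gcongr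
    refine ih (t + 1) (hA.mono (by omega)) fun s hs ω => ?_
    have h := hγ (s + 1) (by omega) ω
    rw [show k + 1 - 1 - (s + 1) = k - 1 - s by omega] at h
    rw [show t + 1 + s = t + (s + 1) by omega]
    exact h

end

end POMDP

namespace POMDP

/-! ### Comparison of the cost of a policy with the value of the finite model -/

section

variable {X Y U : Type*} [MeasurableSpace X] [MeasurableSpace Y] [MeasurableSpace U]

/-- The discounted cost of a trajectory from time `N` on. -/
def discountedCost (M : POMDP X Y U) (β : ℝ) (N : ℕ) (ω : ℕ → X × Y × U) : ℝ :=
  ∑' t : ℕ, β ^ t * M.cost (ω (N + t)).1 (ω (N + t)).2.2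

theorem hasSum_discountedCost (M : POMDP X Y U) {β C : ℝ} (hβ : 0 ≤ β) (hβ1 : β < 1)
    (hC : ∀ x u, |M.cost x u| ≤ C) (N : ℕ) (ω : ℕ → X × Y × U) :
    HasSum (fun t => β ^ t * M.cost (ω (N + t)).1 (ω (N + t)).2.2) (M.discountedCost β N ω) := by
  refine Summable.hasSum (.of_norm_bounded (g := fun t => β ^ t * C)
    ((summable_geometric_of_lt_one hβ hβ1).mul_right C) fun t => ?_)
  rw [Real.norm_eq_abs, abs_mul, abs_of_nonneg (pow_nonneg hβ t)]
  exact mul_le_mul_of_nonneg_left (hC _ _) (pow_nonneg hβ t)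

theorem abs_discountedCost_le (M : POMDP X Y U) {β C : ℝ} (hβ : 0 ≤ β) (hβ1 : β < 1)
    (hC : ∀ x u, |M.cost x u| ≤ C) (N : ℕ) (ω : ℕ → X × Y × U) :
    |M.discountedCost β N ω| ≤ (1 - β)⁻¹ * C := by
  rw [discountedCost, ← Real.norm_eq_abs]
  refine tsum_of_norm_bounded ((hasSum_geometric_of_lt_one hβ hβ1).mul_right C) fun t => ?_
  rw [Real.norm_eq_abs, abs_mul, abs_of_nonneg (pow_nonneg hβ t)]
  exact mul_le_mul_of_nonneg_left (hC _ _) (pow_nonneg hβ t)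

/-- The discounted values of J telescope. -/
theorem sum_residual (M : POMDP X Y U) (β : ℝ) {N : ℕ} (J : Window Y U N → ℝ) (T : ℕ)
    (ω : ℕ → X × Y × U) :
    ∑ t ∈ Finset.range T, β ^ t * M.residual β J t ω =
      J (windowAt N 0 ω) - β ^ T * J (windowAt N T ω) -
        ∑ t ∈ Finset.range T, β ^ t * M.cost (ω (N + t)).1 (ω (N + t)).2.2 := by
  induction T with
  | zero => simp
  | succ T ih =>
    rw [Finset.sum_range_succ, ih, Finset.sum_range_succ, residual, Nat.add_comm T N]
    ring

theorem tendsto_sum_residual (M : POMDP X Y U) {β C B : ℝ} (hβ : 0 ≤ β) (hβ1 : β < 1)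
    (hC : ∀ x u, |M.cost x u| ≤ C) {N : ℕ} {J : Window Y U N → ℝ} (hJ : ∀ w, |J w| ≤ B)
    (ω : ℕ → X × Y × U) :
    Filter.Tendsto (fun T => ∑ t ∈ Finset.range T, β ^ t * M.residual β J t ω) Filter.atTop
      (nhds (J (windowAt N 0 ω) - M.discountedCost β N ω)) := by
  simp only [sum_residual]
  have h₁ : Filter.Tendsto (fun T => β ^ T * J (windowAt N T ω)) Filter.atTop (nhds 0) := by
    refine squeeze_zero_norm (a := fun T => β ^ T * B) (fun T => ?_) ?_
    · rw [Real.norm_eq_abs, abs_mul, abs_of_nonneg (pow_nonneg hβ T)]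
      exact mul_le_mul_of_nonneg_left (hJ _) (pow_nonneg hβ T)
    · simpa using (tendsto_pow_atTop_nhds_zero_of_lt_one hβ hβ1).mul_const B
  have h₂ := (M.hasSum_discountedCost hβ hβ1 hC N ω).tendsto_sum_nat
  simpa using (tendsto_const_nhds.sub h₁).sub h₂

theorem abs_sum_residual_le (M : POMDP X Y U) {β C B : ℝ} (hβ : 0 ≤ β) (hβ1 : β < 1)
    (hC : ∀ x u, |M.cost x u| ≤ C) {N : ℕ} {J : Window Y U N → ℝ} (hJ : ∀ w, |J w| ≤ B) (T : ℕ)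
    (ω : ℕ → X × Y × U) :
    |∑ t ∈ Finset.range T, β ^ t * M.residual β J t ω| ≤ (1 - β)⁻¹ * (B + (C + β * B)) := by
  have hs := (hasSum_geometric_of_lt_one hβ hβ1).mul_right (B + (C + β * B))
  have h₀ : 0 ≤ B + (C + β * B) := (abs_nonneg _).trans (M.abs_residual_le hβ hC hJ 0 ω)
  refine (Finset.abs_sum_le_sum_abs _ _).trans (le_trans (Finset.sum_le_sum fun t _ => ?_)
    (sum_le_hasSum (Finset.range T) (fun t _ => mul_nonneg (pow_nonneg hβ t) h₀) hs))
  rw [abs_mul, abs_of_nonneg (pow_nonneg hβ t)]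
  exact mul_le_mul_of_nonneg_left (M.abs_residual_le hβ hC hJ t ω) (pow_nonneg hβ t)

variable [Finite U] [MeasurableSingletonClass U]

theorem measurable_discountedCost (M : POMDP X Y U)
    (hcm : ∀ u, Measurable fun x => M.cost x u) {β C : ℝ} (hβ : 0 ≤ β) (hβ1 : β < 1)
    (hC : ∀ x u, |M.cost x u| ≤ C) (N : ℕ) : Measurable (M.discountedCost β N) :=
  measurable_of_tendsto_metrizable
    (fun T => Finset.measurable_sum (Finset.range T) fun t _ =>
      (M.measurable_cost_comp hcm (N + t)).const_mul (β ^ t))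
    (tendsto_pi_nhds.2 fun ω => by
      simpa using (M.hasSum_discountedCost hβ hβ1 hC N ω).tendsto_sum_nat)

variable [Finite Y] [MeasurableSingletonClass Y]

theorem measure_obsEvent_window (M : POMDP X Y U) (z : ProbabilityMeasure X) (γ : Policy Y U)
    {N : ℕ} (ω₀ : ℕ → X × Y × U) :
    M.pathLaw z (Policy.withPrefix (windowAt N 0 ω₀).2 γ) (obsEvent (windowAt N 0 ω₀).1) =
      M.ufilt z (obsOf ω₀) (actOf ω₀) N Set.univ := by
  classical
  have h := congrArg (fun μ => μ Set.univ) (M.map_state_restrict_obs z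
    (Policy.withPrefix (fun i : Fin N => actOf ω₀ i) γ) N (obsOf ω₀) (actOf ω₀))
  rw [if_pos (Policy.consistent_withPrefix _ le_rfl _ _)] at h
  rw [← h, windowAt_zero, measure_congr (M.obsEvent_succ_ae_eq z γ N (obsOf ω₀) (actOf ω₀)),
    Measure.map_apply (by fun_prop) MeasurableSet.univ]
  simp

end

/-! ### Bellman defects and costs bounded by filter gaps -/

section

variable {X Y U : Type*} [MetricSpace X] [MeasurableSpace X] [BorelSpace X]
  [SecondCountableTopology X] [MeasurableSpace Y]
  [MeasurableSpace U] [Finite Y] [MeasurableSingletonClass Y] [Finite U]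
  [MeasurableSingletonClass U] [Nonempty U]

/-- The core estimate. The defect is integrated against the true filter, while its sign is known for
the filter started from `zstar`; the two integrals of the K-Lipschitz `qfun` differ by at most K
times the gap. The sign ε = 1 serves all policies and ε = -1 the policy φ. -/
theorem ofReal_setIntegral_residual_cylOf_le (M : POMDP X Y U)
    (hcm : ∀ u, Measurable fun x => M.cost x u) {β C K D : ℝ} (hC : ∀ x u, |M.cost x u| ≤ C)
    (hK : 0 ≤ K) {N : ℕ} {J : Window Y U N → ℝ} (ρ : Window Y U N → ProbabilityMeasure X)
    (hL : ∀ w u x x', |M.qfun β J w u x - M.qfun β J w u x'| ≤ K * dist x x')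
    (hD : ∀ w u x, |M.qfun β J w u x| ≤ D) (zstar z : ProbabilityMeasure X) (γ : Policy Y U)
    {ε : ℝ} (hε : |ε| = 1) (t : ℕ) (ω₀ : ℕ → X × Y × U)
    (hopt : M.pathLaw z γ (cylOf (t + N + 1) ω₀) ≠ 0 →
      ε * (J (windowAt N t ω₀) -
        M.approxQ β ρ zstar J (windowAt N t ω₀) (actOf ω₀ (t + N))) ≤ 0) :
    ENNReal.ofReal (∫ ω in cylOf (t + N + 1) ω₀, ε * M.residual β J t ω ∂M.pathLaw z γ) ≤
      ENNReal.ofReal K * (M.filterGap ρ zstar (M.predAt z t ω₀) (windowAt N t ω₀) *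
        M.pathLaw z γ (cylOf (t + N + 1) ω₀)) := by
  by_cases h0 : M.pathLaw z γ (cylOf (t + N + 1) ω₀) = 0
  · rw [setIntegral_measure_zero _ h0]; simp
  have hγ := M.consistent_of_measure_ne_zero z γ _ ω₀ h0
  have hm := M.measure_cylOf_succ z γ (t + N) ω₀ hγ
  have hσ : M.ufilt z (obsOf ω₀) (actOf ω₀) (t + N) Set.univ ≠ 0 := hm ▸ h0
  have hopt := hopt h0
  rw [integral_const_mul, M.integral_residual hcm hC J z γ t ω₀ hγ,
    M.ufilt_eq_smul_filter z ρ t ω₀ hσ, ← hm, integral_smul_measure, smul_eq_mul]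
  rw [approxQ_eq_integral M β ρ zstar J _ _ (hcm _) fun x => hC x _] at hopt
  set w := windowAt N t ω₀
  set u := actOf ω₀ (t + N)
  set ψ := M.filter ρ (M.predAt z t ω₀) w
  set ψs := M.filter ρ zstar w
  have hqm : Measurable (M.qfun β J w u) :=
    (hcm u).add ((M.measurable_integral_comp u fun y => J (w.next u y)).const_mul β)
  have hqi : Integrable (M.qfun β J w u) (ψ : Measure X) :=
    .of_bound hqm.aestronglyMeasurable D (Filter.Eventually.of_forall (hD w u))
  -- By `hopt`, ε (J - ∫ q dψ) ≤ ε (∫ q dψs - ∫ q dψ), so the function to test is -ε q.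
  have hw := integral_sub_integral_le_wasserstein (ψ : Measure X) (ψs : Measure X)
    (f := fun x => -ε * M.qfun β J w u x) (C := D) hK (fun x x' => by
      rw [← mul_sub, abs_mul, abs_neg, hε, one_mul]; exact hL w u x x') (fun x => by
      rw [abs_mul, abs_neg, hε, one_mul]; exact hD w u x)
  rw [integral_const_mul, integral_const_mul] at hw
  rw [integral_sub (integrable_const _) hqi]
  simp only [integral_const, probReal_univ, one_smul]
  rw [mul_left_comm, ENNReal.ofReal_mul ENNReal.toReal_nonneg,
    ENNReal.ofReal_toReal (measure_ne_top _ _), ← mul_assoc, mul_comm]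
  gcongr
  refine (ENNReal.ofReal_le_ofReal ?_).trans hw
  linarith

/-- Sum the one-step estimates with weights β^t, pass to the worst gaps to remove the dependence on
the policy, and let the number of steps grow. -/
theorem ofReal_setIntegral_value_sub_cost_le (M : POMDP X Y U)
    (hcm : ∀ u, Measurable fun x => M.cost x u) {β C B K D : ℝ} (hβ : 0 ≤ β) (hβ1 : β < 1)
    (hC : ∀ x u, |M.cost x u| ≤ C)
    (hK : 0 ≤ K) {N : ℕ} {J : Window Y U N → ℝ} (hJ : ∀ w, |J w| ≤ B)
    (ρ : Window Y U N → ProbabilityMeasure X)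
    (hL : ∀ w u x x', |M.qfun β J w u x - M.qfun β J w u x'| ≤ K * dist x x')
    (hD : ∀ w u x, |M.qfun β J w u x| ≤ D) (zstar z : ProbabilityMeasure X) (γ : Policy Y U)
    {ε : ℝ} (hε : |ε| = 1) {A : Set (ℕ → X × Y × U)} (hA : IsPrefixSet (N + 1) A)
    (hopt : ∀ t, ∀ ω₀ : ℕ → X × Y × U, M.pathLaw z γ (cylOf (t + N + 1) ω₀) ≠ 0 →
      ε * (J (windowAt N t ω₀) -
        M.approxQ β ρ zstar J (windowAt N t ω₀) (actOf ω₀ (t + N))) ≤ 0) :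
    ENNReal.ofReal (ε * ∫ ω in A, (J (windowAt N 0 ω) - M.discountedCost β N ω) ∂M.pathLaw z γ) ≤
      ENNReal.ofReal K * ∫⁻ ω in A,
        ⨆ k, M.worstGap β ρ zstar k (M.predAt z 0 ω) (windowAt N 0 ω) ∂M.pathLaw z γ := by
  have hrm := M.measurable_residual hcm β J
  have hri : ∀ t, Integrable (M.residual β J t) (M.pathLaw z γ) := fun t =>
    .of_bound (hrm t).aestronglyMeasurable _
      (Filter.Eventually.of_forall (M.abs_residual_le hβ hC hJ t))
  have hstep : ∀ t, ENNReal.ofReal (∫ ω in A, ε * M.residual β J t ω ∂M.pathLaw z γ) ≤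
      ENNReal.ofReal K * ∫⁻ ω in A,
        M.filterGap ρ zstar (M.predAt z t ω) (windowAt N t ω) ∂M.pathLaw z γ := by
    intro t
    rw [← lintegral_const_mul' _ _ ENNReal.ofReal_ne_top]
    refine ofReal_setIntegral_le_of_cyl (hA.mono (by omega : N + 1 ≤ t + N + 1))
      ((hri t).const_mul ε) fun ω₀ _ => ?_
    rw [lintegral_const_mul' _ _ ENNReal.ofReal_ne_top,
      M.setLIntegral_cylOf_prefix z γ (M.isPrefixFun_gap z le_rfl (M.filterGap ρ zstar))]
    exact M.ofReal_setIntegral_residual_cylOf_le hcm hC hK ρ hL hD zstar z γ hε t ω₀ (hopt t ω₀)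
  have hsum : ∀ T, ENNReal.ofReal (ε * ∫ ω in A, ∑ t ∈ Finset.range T, β ^ t * M.residual β J t ω
      ∂M.pathLaw z γ) ≤ ENNReal.ofReal K * ∫⁻ ω in A,
        ⨆ k, M.worstGap β ρ zstar k (M.predAt z 0 ω) (windowAt N 0 ω) ∂M.pathLaw z γ := by
    intro T
    rw [integral_finsetSum _ fun t _ => ((hri t).integrableOn).const_mul _, Finset.mul_sum]
    calc _ ≤ ∑ t ∈ Finset.range T, ENNReal.ofReal
            (ε * ∫ ω in A, β ^ t * M.residual β J t ω ∂M.pathLaw z γ) := ENNReal.ofReal_sum_le _ _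
      _ ≤ ENNReal.ofReal K * M.gapSum β ρ zstar z γ A 0 T := by
        rw [gapSum, Finset.mul_sum]
        refine Finset.sum_le_sum fun t _ => ?_
        rw [integral_const_mul, mul_left_comm, ENNReal.ofReal_mul (pow_nonneg hβ t),
          ← integral_const_mul, mul_left_comm, Nat.zero_add]
        gcongr
        exact hstep t
      _ ≤ _ := by
        gcongr
        refine (M.gapSum_le_worstGap hβ ρ zstar z γ T 0 (hA.mono (by omega))).trans
          (lintegral_mono fun ω => ?_)
        exact le_iSup (fun k => M.worstGap β ρ zstar k (M.predAt z 0 ω) (windowAt N 0 ω)) T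
  -- Dominated convergence: bounded defects with geometric weights have uniformly bounded partial
  -- sums.
  have hlim : Filter.Tendsto
      (fun T => ∫ ω in A, ∑ t ∈ Finset.range T, β ^ t * M.residual β J t ω ∂M.pathLaw z γ)
      Filter.atTop
      (nhds (∫ ω in A, (J (windowAt N 0 ω) - M.discountedCost β N ω) ∂M.pathLaw z γ)) :=
    tendsto_integral_of_dominated_convergence (fun _ => (1 - β)⁻¹ * (B + (C + β * B)))
      (fun T => (Finset.measurable_fun_sum _ fun t _ => (hrm t).const_mul _).aestronglyMeasurable)
      (integrable_const _) (fun T => Filter.Eventually.of_forall fun ω =>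
        M.abs_sum_residual_le hβ hβ1 hC hJ T ω)
      (Filter.Eventually.of_forall fun ω => M.tendsto_sum_residual hβ hβ1 hC hJ ω)
  exact le_of_tendsto' (ENNReal.tendsto_ofReal (hlim.const_mul ε)) hsum

/-- Conditional form of the previous estimate: on the conditioning event the initial window is
almost surely constant, and so is the worst gap, hence one may divide by the probability of the
event. -/
theorem ofReal_value_sub_costFrom_le (M : POMDP X Y U)
    (hcm : ∀ u, Measurable fun x => M.cost x u) {β C B K D : ℝ} (hβ : 0 ≤ β) (hβ1 : β < 1)
    (hC : ∀ x u, |M.cost x u| ≤ C)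
    (hK : 0 ≤ K) {N : ℕ} {J : Window Y U N → ℝ} (hJ : ∀ w, |J w| ≤ B)
    (ρ : Window Y U N → ProbabilityMeasure X)
    (hL : ∀ w u x x', |M.qfun β J w u x - M.qfun β J w u x'| ≤ K * dist x x')
    (hD : ∀ w u x, |M.qfun β J w u x| ≤ D) (zstar z : ProbabilityMeasure X) (γ : Policy Y U)
    {ε : ℝ} (hε : |ε| = 1) (ω₀ : ℕ → X × Y × U)
    (h0 : M.ufilt z (obsOf ω₀) (actOf ω₀) N Set.univ ≠ 0)
    (hopt : ∀ t, ∀ ω : ℕ → X × Y × U,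
      M.pathLaw z (Policy.withPrefix (windowAt N 0 ω₀).2 γ) (cylOf (t + N + 1) ω) ≠ 0 →
      ε * (J (windowAt N t ω) -
        M.approxQ β ρ zstar J (windowAt N t ω) (actOf ω (t + N))) ≤ 0) :
    ENNReal.ofReal (ε * (J (windowAt N 0 ω₀) - M.costFrom β z (windowAt N 0 ω₀) γ)) ≤
      ENNReal.ofReal K *
        ⨆ k, M.worstGap β ρ zstar k (M.predAt z 0 ω₀) (windowAt N 0 ω₀) := by
  set w := windowAt N 0 ω₀ with hw
  set P := M.pathLaw z (Policy.withPrefix w.2 γ)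
  set A : Set (ℕ → X × Y × U) := obsEvent w.1
  have hA : IsPrefixSet (N + 1) A := isPrefixSet_obsEvent w.1
  have hm : P A = M.ufilt z (obsOf ω₀) (actOf ω₀) N Set.univ := M.measure_obsEvent_window z γ ω₀
  have hPA : P A ≠ 0 := hm ▸ h0
  have hPA' : P A ≠ ∞ := measure_ne_top _ _
  have hprob : IsProbabilityMeasure (P[|A]) := cond_isProbabilityMeasure hPA
  have hwin : ∀ᵐ ω ∂P.restrict A, windowAt N 0 ω = w := by
    rw [ae_restrict_iff' hA.measurableSet]
    filter_upwards [M.ae_withPrefix z γ w.2] with ω hω hωA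
    rw [windowAt_zero]
    exact Prod.ext (funext fun i => hωA i) (funext fun i => hω i)
  have hwin' : ∀ᵐ ω ∂P[|A], windowAt N 0 ω = w := by
    rw [ProbabilityTheory.cond]
    exact Measure.ae_smul_measure hwin _
  have hci : Integrable (M.discountedCost β N) (P[|A]) :=
    .of_bound (M.measurable_discountedCost hcm hβ hβ1 hC N).aestronglyMeasurable _
      (Filter.Eventually.of_forall (M.abs_discountedCost_le hβ hβ1 hC N))
  have e : J w - M.costFrom β z w γ =
      (P A).toReal⁻¹ * ∫ ω in A, (J (windowAt N 0 ω) - M.discountedCost β N ω) ∂P := by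
    have e₁ : ∫ ω, (J (windowAt N 0 ω) - M.discountedCost β N ω) ∂(P[|A]) =
        J w - M.costFrom β z w γ := by
      rw [integral_congr_ae (g := fun ω => J w - M.discountedCost β N ω)
        (hwin'.mono fun ω hω => by simp only [hω]), integral_sub (integrable_const _) hci]
      simp only [integral_const, probReal_univ, one_smul]
      rfl
    rw [← e₁, ProbabilityTheory.cond, integral_smul_measure, ENNReal.toReal_inv, smul_eq_mul]
  have key := M.ofReal_setIntegral_value_sub_cost_le hcm hβ hβ1 hC hK hJ ρ hL hD zstar z
    (Policy.withPrefix w.2 γ) hε hA hopt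
  rw [lintegral_congr_ae (g := fun _ => ⨆ k, M.worstGap β ρ zstar k (M.predAt z 0 ω₀) w)
    (hwin.mono fun ω hω => by
      simp only [hω, M.isPrefixFun_predAt z (le_refl 0) ω₀ ω fun i hi => absurd hi (Nat.not_lt_zero i)]),
    setLIntegral_const] at key
  rw [e, mul_left_comm, ENNReal.ofReal_mul (inv_nonneg.2 ENNReal.toReal_nonneg),
    ← ENNReal.toReal_inv, ENNReal.ofReal_toReal (ENNReal.inv_ne_top.2 hPA)]
  calc _ ≤ (P A)⁻¹ * (ENNReal.ofReal K *
        ((⨆ k, M.worstGap β ρ zstar k (M.predAt z 0 ω₀) w) * P A)) := by gcongr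
    _ = ((P A)⁻¹ * P A) * (ENNReal.ofReal K * ⨆ k, M.worstGap β ρ zstar k (M.predAt z 0 ω₀) w) := by
      ring
    _ = _ := by rw [ENNReal.inv_mul_cancel hPA hPA', one_mul]

end

end POMDP

/-! ### Policies in the predictor and the window -/

theorem slidingPolicy_apply {X Y U : Type*} [Nonempty U] {N : ℕ} (φ : Window Y U N → U) (t : ℕ)
    (ω : ℕ → X × Y × U) :
    slidingPolicy φ (t + N) (fun i => obsOf ω i) (fun i => actOf ω i) = φ (windowAt N t ω) := by
  simp only [slidingPolicy, Nat.le_add_left, dite_true, Nat.add_sub_cancel]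
  rfl

namespace POMDP

section

variable {X Y U : Type*} [MeasurableSpace X] [MeasurableSpace Y] [MeasurableSpace U]
  [Finite Y] [MeasurableSingletonClass Y] [Finite U] [MeasurableSingletonClass U]

/-- The probability of a window depends on the policy only through whether it prescribes the N
actions in it. -/
theorem map_windowAt_zero_congr (M : POMDP X Y U) (z : ProbabilityMeasure X) {γ γ' : Policy Y U}
    {N : ℕ} (h : ∀ n < N, γ n = γ' n) :
    (M.pathLaw z γ).map (windowAt N 0) = (M.pathLaw z γ').map (windowAt N 0) := by
  classical
  refine Measure.ext_of_singleton fun w => ?_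
  rw [Measure.map_apply (measurable_windowAt N 0) (measurableSet_singleton w),
    Measure.map_apply (measurable_windowAt N 0) (measurableSet_singleton w)]
  by_cases hw : ∃ ω₀ : ℕ → X × Y × U, windowAt N 0 ω₀ = w
  · obtain ⟨ω₀, rfl⟩ := hw
    have e : (windowAt N 0 : (ℕ → X × Y × U) → Window Y U N) ⁻¹' {windowAt N 0 ω₀} =
        cyl N (obsOf ω₀) (actOf ω₀) ∩ {ω | (ω N).2.1 = obsOf ω₀ N} := by
      ext ω
      simp only [Set.mem_preimage, Set.mem_singleton_iff, windowAt_zero]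
      constructor
      · intro hω
        have h₁ := congrFun (congrArg Prod.fst hω)
        have h₂ := congrFun (congrArg Prod.snd hω)
        exact ⟨fun i hi => ⟨h₁ ⟨i, by omega⟩, h₂ ⟨i, hi⟩⟩, h₁ ⟨N, by omega⟩⟩
      · rintro ⟨h₁, h₂⟩
        refine Prod.ext (funext fun i => ?_) (funext fun i => (h₁ i i.2).2)
        rcases Nat.lt_succ_iff_lt_or_eq.1 i.2 with hi | hi
        · exact (h₁ i hi).1
        · change obsOf ω i = obsOf ω₀ i
          rw [hi]; exact h₂
    have hc : γ.Consistent N (obsOf ω₀) (actOf ω₀) ↔ γ'.Consistent N (obsOf ω₀) (actOf ω₀) :=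
      forall₂_congr fun i hi => by rw [h i hi]
    have key : ∀ δ : Policy Y U,
        M.pathLaw z δ (cyl N (obsOf ω₀) (actOf ω₀) ∩ {ω | (ω N).2.1 = obsOf ω₀ N}) =
          if δ.Consistent N (obsOf ω₀) (actOf ω₀) then
            M.ufilt z (obsOf ω₀) (actOf ω₀) N Set.univ else 0 := by
      intro δ
      have h₁ := congrArg (fun μ => μ Set.univ)
        (M.map_state_restrict_obs z δ N (obsOf ω₀) (actOf ω₀))
      rw [Measure.map_apply (by fun_prop) MeasurableSet.univ, Set.preimage_univ,
        Measure.restrict_apply_univ] at h₁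
      rw [h₁]
      split_ifs <;> rfl
    rw [e, key, key]
    simp only [hc]
  · have e : (windowAt N 0 : (ℕ → X × Y × U) → Window Y U N) ⁻¹' {w} = ∅ := by
      ext ω
      simp only [Set.mem_preimage, Set.mem_singleton_iff, Set.mem_empty_iff_false, iff_false]
      exact fun hω => hw ⟨ω, hω⟩
    rw [e]; simp

/-- The likelihood of the realised data bounds the probability of their cylinder, and there are
finitely many cylinders; so data of zero likelihood almost surely do not occur. -/
theorem ae_ufilt_ne_zero (M : POMDP X Y U) (z : ProbabilityMeasure X) (γ : Policy Y U) (n : ℕ) :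
    ∀ᵐ ω ∂M.pathLaw z γ, M.ufilt z (obsOf ω) (actOf ω) n Set.univ ≠ 0 := by
  let A : Set (ℕ → X × Y × U) := {ω | M.ufilt z (obsOf ω) (actOf ω) n Set.univ = 0}
  have hA : IsPrefixSet (n + 1) A := fun ω hω ω' hω' => by
    change M.ufilt z (obsOf ω') (actOf ω') n Set.univ = 0
    rw [M.ufilt_congr z (y := obsOf ω') (u := actOf ω') (y' := obsOf ω) (u' := actOf ω) (fun i hi => (hω' i hi).1) (fun i hi => (hω' i (by omega)).2)]
    exact hω
  have h : ∫⁻ _ in A, 1 ∂M.pathLaw z γ ≤ ∫⁻ _ in A, 0 ∂M.pathLaw z γ := by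
    refine setLIntegral_le_of_cyl hA fun ω hω => ?_
    rw [setLIntegral_const, one_mul]
    by_contra! h0
    simp only [lintegral_zero] at h0
    rw [M.measure_cylOf_succ z γ n ω (M.consistent_of_measure_ne_zero z γ _ ω h0.ne')] at h0
    exact h0.ne' hω
  rw [ae_iff]
  simpa [A] using h

variable [Nonempty U]

/-- The policy that follows `γ` before time `N` and plays `g t ẑ_t` at time `N + t`. -/
def windowMarkovPolicy (M : POMDP X Y U) (z : ProbabilityMeasure X) {N : ℕ} (γ : Policy Y U)
    (g : ℕ → ProbabilityMeasure X → Window Y U N → U) : Policy Y U := fun n ys us =>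
  if h : N ≤ n then
    g (n - N) (M.predictor z (n - N) (fun i => ys ⟨i, by omega⟩) (fun i => us ⟨i, by omega⟩))
      (fun i => ys ⟨n - N + i, by omega⟩, fun i => us ⟨n - N + i, by omega⟩)
  else γ n ys us

theorem windowMarkovPolicy_apply (M : POMDP X Y U) (z : ProbabilityMeasure X) {N : ℕ}
    (γ : Policy Y U) (g : ℕ → ProbabilityMeasure X → Window Y U N → U) {n t : ℕ} (h : n = t + N)
    (ys : Fin (n + 1) → Y) (us : Fin n → U) :
    M.windowMarkovPolicy z γ g n ys us =
      g t (M.predictor z t (fun i => ys ⟨i, by omega⟩) (fun i => us ⟨i, by omega⟩))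
        (fun i => ys ⟨t + i, by omega⟩, fun i => us ⟨t + i, by omega⟩) := by
  obtain rfl : t = n - N := by omega
  exact dif_pos (by omega)

theorem isWindowMarkov_windowMarkovPolicy (M : POMDP X Y U) (z : ProbabilityMeasure X) {N : ℕ}
    (γ : Policy Y U) (g : ℕ → ProbabilityMeasure X → Window Y U N → U) :
    M.IsWindowMarkov N z (M.windowMarkovPolicy z γ g) :=
  ⟨g, fun t ys us => M.windowMarkovPolicy_apply z γ g (Nat.add_comm N t) ys us⟩

end

/-! ### The worst gap is attained by a policy of the class -/

section

variable {X Y U : Type*} [MetricSpace X] [MeasurableSpace X] [MeasurableSpace Y]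
  [MeasurableSpace U] [Finite Y] [MeasurableSingletonClass Y] [Finite U]
  [MeasurableSingletonClass U] [Nonempty U]

/-- Exchanges expectation and supremum: one feedback attains the worst gap for all initial windows
simultaneously, and it is a competitor in each stability term. -/
theorem lintegral_worstGap_le_stabilityTerm (M : POMDP X Y U) {β : ℝ} (hβ : 0 ≤ β) {N : ℕ}
    (ρ : Window Y U N → ProbabilityMeasure X) (zstar z : ProbabilityMeasure X) (γ : Policy Y U)
    (k : ℕ) :
    ∫⁻ ω, M.worstGap β ρ zstar k (M.predAt z 0 ω) (windowAt N 0 ω) ∂M.pathLaw z γ ≤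
      ∑' t : ℕ, ENNReal.ofReal (β ^ t) * M.stabilityTerm N ρ z zstar t := by
  -- At time N + t the remaining horizon is k - 1 - t; the truncation at 0 for t ≥ k is harmless, as
  -- only k gaps are summed.
  let γ' := M.windowMarkovPolicy z γ fun t => M.worstAction β ρ zstar (k - 1 - t)
  obtain ⟨ω₀⟩ : Nonempty (ℕ → X × Y × U) := nonempty_of_isProbabilityMeasure (M.pathLaw z γ)
  have h₁ : ∀ δ : Policy Y U,
      ∫⁻ ω, M.worstGap β ρ zstar k (M.predAt z 0 ω) (windowAt N 0 ω) ∂M.pathLaw z δ =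
        ∫⁻ w, M.worstGap β ρ zstar k (M.predAt z 0 ω₀) w
          ∂(M.pathLaw z δ).map (windowAt N 0) := by
    intro δ
    rw [lintegral_map (measurable_of_countable _) (measurable_windowAt N 0)]
    refine lintegral_congr fun ω => ?_
    rw [M.isPrefixFun_predAt z (le_refl 0) ω₀ ω fun i hi => absurd hi (Nat.not_lt_zero i)]
  have hag : ∀ n < N, γ n = γ' n := fun n hn => by
    ext ys us
    simp only [γ', windowMarkovPolicy, dif_neg (Nat.not_le.2 hn)]
  -- The integrand depends on the initial window only, whose law does not change when the policy is
  -- altered from time N on.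
  rw [h₁ γ, M.map_windowAt_zero_congr z hag, ← h₁ γ']
  have h₂ := M.worstGap_le_gapSum hβ ρ zstar z γ' k 0 (isPrefixSet_univ _) fun s _ ω => by
    refine (M.windowMarkovPolicy_apply z γ _ rfl _ _).trans ?_
    rw [Nat.zero_add]
    rfl
  rw [Measure.restrict_univ] at h₂
  refine h₂.trans (le_trans ?_ (ENNReal.sum_le_tsum (Finset.range k)))
  refine Finset.sum_le_sum fun t _ => ?_
  gcongr
  rw [Measure.restrict_univ, Nat.zero_add]
  exact le_iSup₂_of_le γ' (M.isWindowMarkov_windowMarkovPolicy z γ _) le_rfl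

end

section

variable {X Y U : Type*} [MetricSpace X] [MeasurableSpace X] [BorelSpace X]
  [SecondCountableTopology X] [MeasurableSpace Y]
  [MeasurableSpace U] [Finite Y] [MeasurableSingletonClass Y] [Finite U]
  [MeasurableSingletonClass U] [Nonempty U]

/-- J is the pivot: every cost is at least J - K G, and the cost of φ is at most J + K G. As G does
not depend on the policy, the first bound passes to the infimum. -/
theorem ofReal_abs_costFrom_sub_optCostFrom_le (M : POMDP X Y U)
    (hcm : ∀ u, Measurable fun x => M.cost x u) {β C B K D : ℝ} (hβ : 0 ≤ β) (hβ1 : β < 1)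
    (hC : ∀ x u, |M.cost x u| ≤ C)
    (hK : 0 ≤ K) {N : ℕ} {J : Window Y U N → ℝ} (hJ : ∀ w, |J w| ≤ B)
    (ρ : Window Y U N → ProbabilityMeasure X)
    (hL : ∀ w u x x', |M.qfun β J w u x - M.qfun β J w u x'| ≤ K * dist x x')
    (hD : ∀ w u x, |M.qfun β J w u x| ≤ D) (zstar z : ProbabilityMeasure X)
    {φ : Window Y U N → U}
    (hφ : ∀ w, J w = M.approxQ β ρ zstar J w (φ w) ∧ ∀ u, J w ≤ M.approxQ β ρ zstar J w u)
    (ω₀ : ℕ → X × Y × U) (h0 : M.ufilt z (obsOf ω₀) (actOf ω₀) N Set.univ ≠ 0) :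
    ENNReal.ofReal |M.costFrom β z (windowAt N 0 ω₀) (slidingPolicy φ) -
        M.optCostFrom β z (windowAt N 0 ω₀)| ≤
      ENNReal.ofReal (2 * K) *
        ⨆ k, M.worstGap β ρ zstar k (M.predAt z 0 ω₀) (windowAt N 0 ω₀) := by
  set w := windowAt N 0 ω₀ with hw
  set G := ⨆ k, M.worstGap β ρ zstar k (M.predAt z 0 ω₀) w
  have hup : ∀ γ : Policy Y U,
      ENNReal.ofReal (J w - M.costFrom β z w γ) ≤ ENNReal.ofReal K * G := by
    intro γ
    have h := M.ofReal_value_sub_costFrom_le hcm hβ hβ1 hC hK hJ ρ hL hD zstar z γ (ε := 1)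
      (by simp) ω₀ h0 fun t ω _ => by
        rw [one_mul]; exact sub_nonpos.2 ((hφ _).2 _)
    rwa [one_mul] at h
  have hlow : ENNReal.ofReal (M.costFrom β z w (slidingPolicy φ) - J w) ≤
      ENNReal.ofReal K * G := by
    have h := M.ofReal_value_sub_costFrom_le hcm hβ hβ1 hC hK hJ ρ hL hD zstar z
      -- The prescribed prefix ends before time N, so from then on the actions on non-null cylinders
      -- are those of φ and the Bellman inequality is an equality.
      (slidingPolicy φ) (ε := -1) (by simp) ω₀ h0 fun t ω hω => by
        have hc := M.consistent_of_measure_ne_zero z _ _ ω hω (t + N) (by omega)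
        have hu : actOf ω (t + N) = φ (windowAt N t ω) := by
          rw [← hc, ← slidingPolicy_apply φ]
          exact dif_neg (by omega)
        rw [hu, ← (hφ _).1]; simp
    rwa [neg_one_mul, neg_sub] at h
  rw [mul_comm 2 K, ENNReal.ofReal_mul hK, ENNReal.ofReal_ofNat, mul_right_comm, mul_comm _ 2]
  -- A real infimum lies below its members only if the family is bounded below.
  have hbdd : BddBelow (Set.range fun γ : Policy Y U => M.costFrom β z w γ) := by
    refine ⟨-((1 - β)⁻¹ * C), ?_⟩
    rintro _ ⟨γ, rfl⟩
    have hp : M.pathLaw z (Policy.withPrefix w.2 γ) (obsEvent w.1) ≠ 0 := by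
      rw [hw, M.measure_obsEvent_window z γ ω₀]; exact h0
    have := cond_isProbabilityMeasure hp
    exact (abs_le.1 (abs_integral_le_of_forall _ (M.abs_discountedCost_le hβ hβ1 hC N))).1
  have hle : M.optCostFrom β z w ≤ M.costFrom β z w (slidingPolicy φ) := ciInf_le hbdd _
  rw [abs_of_nonneg (sub_nonneg.2 hle)]
  by_cases hE : ENNReal.ofReal K * G = ∞
  · rw [hE]; simp
  · have h₁ : J w - (ENNReal.ofReal K * G).toReal ≤ M.optCostFrom β z w := by
      have : Nonempty (Policy Y U) := ⟨slidingPolicy φ⟩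
      refine le_ciInf fun γ => ?_
      have := (ENNReal.ofReal_le_iff_le_toReal hE).1 (hup γ)
      linarith
    have h₂ := (ENNReal.ofReal_le_iff_le_toReal hE).1 hlow
    rw [ENNReal.ofReal_le_iff_le_toReal (ENNReal.mul_ne_top (by simp) hE), ENNReal.toReal_mul]
    simp only [ENNReal.toReal_ofNat]
    linarith

end

end POMDP

/-! ### The error bound -/

theorem mainTheorem1 {X Y U : Type*}
    [MetricSpace X] [SecondCountableTopology X] [MeasurableSpace X] [BorelSpace X]
    [StandardBorelSpace X]
    [Finite Y] [MeasurableSpace Y] [MeasurableSingletonClass Y]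
    [Finite U] [Nonempty U] [MeasurableSpace U] [MeasurableSingletonClass U]
    (M : POMDP X Y U) (β : ℝ) (hβ0 : 0 < β) (hβ1 : β < 1)
    (α K₁ : ℝ) (hα : 0 ≤ α) (hK₁ : 0 ≤ K₁)
    (hT : ∀ (x x' : X) (u : U),
      tvDist (M.transition (x, u)) (M.transition (x', u)) ≤ α * dist x x')
    (hc : ∀ (x x' : X) (u : U), |M.cost x u - M.cost x' u| ≤ K₁ * dist x x')
    (hbdd : ∃ C : ℝ, ∀ (x : X) (u : U), |M.cost x u| ≤ C)
    (N : ℕ) (z zstar : ProbabilityMeasure X)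
    (ρ : Window Y U N → ProbabilityMeasure X)
    (φ : Window Y U N → U) (hφ : M.IsApproxOptimal β ρ zstar φ)
    (γ : Policy Y U) :
    ∫⁻ ω, ENNReal.ofReal
        |M.costFrom β z (windowAt N 0 ω) (slidingPolicy φ)
          - M.optCostFrom β z (windowAt N 0 ω)| ∂(M.pathLaw z γ)
      ≤ ENNReal.ofReal (2 * (K₁ + α * β * (⨆ p : X × U, |M.cost p.1 p.2|) / (1 - β)))
          * ∑' t : ℕ, ENNReal.ofReal (β ^ t) * M.stabilityTerm N ρ z zstar t := by
  obtain ⟨J, hJ⟩ := hφ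
  obtain ⟨C₀, hC₀⟩ := hbdd
  set C : ℝ := ⨆ p : X × U, |M.cost p.1 p.2|
  have hb : BddAbove (Set.range fun p : X × U => |M.cost p.1 p.2|) :=
    ⟨C₀, by rintro _ ⟨p, rfl⟩; exact hC₀ _ _⟩
  have hC : ∀ x u, |M.cost x u| ≤ C := fun x u => le_ciSup hb (x, u)
  have hC0 : 0 ≤ C := Real.iSup_nonneg fun _ => abs_nonneg _
  have hβ : 0 ≤ β := hβ0.le
  have h1β : 0 < 1 - β := by linarith
  have hcm : ∀ u, Measurable fun x => M.cost x u := fun u => by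
    have : LipschitzWith ⟨K₁, hK₁⟩ fun x => M.cost x u :=
      LipschitzWith.of_dist_le_mul fun x x' => hc x x' u
    exact this.continuous.measurable
  have hJB := M.abs_le_of_isFixedPt hβ hβ1 hcm hC (fun w => (hJ w).1)
  have hK : 0 ≤ K₁ + α * β * (C / (1 - β)) := by positivity
  have hL := M.abs_qfun_sub_le hβ hT hc hJB
  rw [mul_div_assoc]
  calc ∫⁻ ω, ENNReal.ofReal |M.costFrom β z (windowAt N 0 ω) (slidingPolicy φ)
          - M.optCostFrom β z (windowAt N 0 ω)| ∂(M.pathLaw z γ)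
      ≤ ∫⁻ ω, ENNReal.ofReal (2 * (K₁ + α * β * (C / (1 - β)))) *
          ⨆ k, M.worstGap β ρ zstar k (M.predAt z 0 ω) (windowAt N 0 ω) ∂M.pathLaw z γ := by
        -- Windows that are null under the prior, where the costs take a default value, have
        -- probability zero under every policy.
        refine lintegral_mono_ae ?_
        filter_upwards [M.ae_ufilt_ne_zero z γ N] with ω hω
        exact M.ofReal_abs_costFrom_sub_optCostFrom_le hcm hβ hβ1 hC hK hJB ρ hL
          (M.abs_qfun_le hβ hC hJB) zstar z hJ ω hω
    _ ≤ _ := by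
        -- Monotone convergence in the horizon; the finite-horizon bounds do not depend on k.
        rw [lintegral_const_mul' _ _ ENNReal.ofReal_ne_top, lintegral_iSup]
        · gcongr
          exact iSup_le fun k => M.lintegral_worstGap_le_stabilityTerm hβ ρ zstar z γ k
        · exact fun k => (M.isPrefixFun_gap z (n := N + 1) (by omega)
            (M.worstGap β ρ zstar k)).measurable
        · exact fun k l hkl ω => M.worstGap_mono β ρ zstar _ _ hkl

end
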